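/- **Notation.** For $\operatorname{Re} z>0$ and $\nu\in\mathbb{C}$ let $K_\nu(z)=\int_0^\infty e^{-z\cosh u}\cosh(\nu u)\,du$ be the modified Bessel function of the second kind. The Kelvin functions $\mathrm{ker}_\nu,\mathrm{kei}_\nu$ are defined for $x>0$ by the two equations $\mathrm{ker}_\nu(x)\pm i\,\mathrm{kei}_\nu(x)=e^{\mp\nu\pi i/2}K_\nu(xe^{\pm\pi i/4})$. For $g:\mathbb{R}_+\to\mathbb{C}$, where $\mathbb{R}_+=(0,\infty)$, put $$(Gg)(x)=\int_0^\infty\left[\mathrm{ker}_{2i\tau}^2\left(2(4x)^{1/4}\right)+\mathrm{kei}_{2i\tau}^2\left(2(4x)^{1/4}\right)\right]g(\tau)\,d\tau,\qquad x>0.$$ Let $f^*(s)=\int_0^\infty f(x)x^{s-1}dx$ be the Mellin transform, let $L_{\gamma,1}(\mathbb{R}_+)$ be the space of measurable $f$ with $\int_0^\infty|f(x)|x^{\gamma-1}dx<\infty$, let $\Gamma$ be Euler's gamma function, and let $B$ be Euler's beta function. **Theorem.** Let $\gamma>0$ and $g\in L_1(\mathbb{R}_+;d\tau)$. Then the integral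 $(Gg)(x)$ converges absolutely for every $x>0$, the function $x^\gamma(Gg)(x)$ is bounded and continuous on $\mathbb{R}_+$, and $$\sup_{x>0}\left|x^\gamma(Gg)(x)\right|\le C_\gamma\,\|g\|_{L_1(\mathbb{R}_+;d\tau)},\qquad C_\gamma=\frac{4^{-\gamma}}{8\pi}\,B(\gamma,\gamma)\int_{\gamma-i\infty}^{\gamma+i\infty}\left|\Gamma^2(2s)\,ds\right|<\infty .$$ If moreover $0<\gamma<1/2$, $Gg\in L_{\gamma,1}(\mathbb{R}_+)$, and $|s|^{1/2-2\gamma}e^{\pi|s|/2}(Gg)^*(s)\in L_1(\gamma-i\infty,\gamma+i\infty)$, then for all $y>0$ $$\frac{1}{2\pi i}\int_{\gamma-i\infty}^{\gamma+i\infty}\frac{\Gamma(1/2-s)}{\Gamma(s)\Gamma(1/2+s)}\,(Gg)^*(s)\,y^{-s}\,ds=\frac{e^{y/2}}{8}\int_0^\infty K_{i\tau}\left(\frac y2\right)\frac{g(\tau)}{\cosh(\pi\tau)}\,d\tau ,$$ where both integrals converge absolutely. -/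

import Mathlib

open Set MeasureTheory

noncomputable section

namespace KelvinIndex

/-- The modified Bessel function of the second kind (Macdonald function)
`K_ν(z) = ∫₀^∞ e^{-z cosh u} cosh(ν u) du`, for `Re z > 0`. -/
def besselK (ν z : ℂ) : ℂ :=
  ∫ u in Ioi (0 : ℝ), Complex.exp (-z * Complex.cosh (u : ℂ)) * Complex.cosh (ν * (u : ℂ))

/-- `e^{-νπi/2} K_ν(x e^{πi/4})`, which is `ker_ν(x) + i kei_ν(x)`. -/
def kelvinPlus (ν : ℂ) (x : ℝ) : ℂ :=
  Complex.exp (-(ν * Real.pi * Complex.I / 2)) *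
    besselK ν (x * Complex.exp (Real.pi * Complex.I / 4))

/-- `e^{νπi/2} K_ν(x e^{-πi/4})`, which is `ker_ν(x) - i kei_ν(x)`. -/
def kelvinMinus (ν : ℂ) (x : ℝ) : ℂ :=
  Complex.exp (ν * Real.pi * Complex.I / 2) *
    besselK ν (x * Complex.exp (-(Real.pi * Complex.I / 4)))

/-- The Kelvin function `ker_ν(x)`, `x > 0`. -/
def kelvinKer (ν : ℂ) (x : ℝ) : ℂ :=
  (kelvinPlus ν x + kelvinMinus ν x) / 2

/-- The Kelvin function `kei_ν(x)`, `x > 0`. -/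
def kelvinKei (ν : ℂ) (x : ℝ) : ℂ :=
  (kelvinPlus ν x - kelvinMinus ν x) / (2 * Complex.I)

/-- The pair of equations that defines the Kelvin functions `ker_ν`, `kei_ν`. -/
theorem kelvinKer_add_sub_kelvinKei (ν : ℂ) (x : ℝ) :
    kelvinKer ν x + Complex.I * kelvinKei ν x = kelvinPlus ν x ∧
    kelvinKer ν x - Complex.I * kelvinKei ν x = kelvinMinus ν x := by
  have hI : Complex.I ≠ 0 := Complex.I_ne_zero
  unfold kelvinKer kelvinKei
  constructor <;> field_simp <;> ring

/-- The kernel `ker²_{2iτ}(2(4x)^{1/4}) + kei²_{2iτ}(2(4x)^{1/4})`. -/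
def kernel (x τ : ℝ) : ℂ :=
  kelvinKer (2 * Complex.I * τ) (2 * (4 * x) ^ (1 / 4 : ℝ)) ^ 2 +
    kelvinKei (2 * Complex.I * τ) (2 * (4 * x) ^ (1 / 4 : ℝ)) ^ 2

/-- The index transform `(Gg)(x) = ∫₀^∞ kernel(x, τ) g(τ) dτ`, `x > 0`. -/
def transformG (g : ℝ → ℂ) (x : ℝ) : ℂ :=
  ∫ τ in Ioi (0 : ℝ), kernel x τ * g τ

/-- Membership in `L_{ν,1}(ℝ₊)`: `f` is a.e. measurable and `∫₀^∞ |f(x)| x^{ν-1} dx < ∞`. -/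
def MemLWeighted (ν : ℝ) (f : ℝ → ℂ) : Prop :=
  IntegrableOn (fun x : ℝ => ((x ^ (ν - 1) : ℝ) : ℂ) * f x) (Ioi 0)

/-- The constant `C_γ = 4^{-γ}/(8π) · B(γ,γ) · ∫_{Re s = γ} |Γ(2s)² ds|`. -/
def constC (γ : ℝ) : ℝ :=
  (4 : ℝ) ^ (-γ) / (8 * Real.pi) * ProbabilityTheory.beta γ γ *
    ∫ t : ℝ, ‖Complex.Gamma (2 * ((γ : ℂ) + (t : ℂ) * Complex.I)) ^ 2‖

/-- The function `s ↦ Γ(1/2-s) / (Γ(s) Γ(1/2+s)) · (Gg)^*(s)`. -/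
def mellinQuotient (g : ℝ → ℂ) (s : ℂ) : ℂ :=
  Complex.Gamma (1 / 2 - s) / (Complex.Gamma s * Complex.Gamma (1 / 2 + s)) *
    mellin (transformG g) s

end KelvinIndex

end

namespace KelvinIndex

/-! Since ker² + kei² = (ker + i kei)(ker − i kei), the kernel is K_{2iτ}(z) K_{2iτ}(z̄) with arg z
= π/4 (`kernel_eq_besselK_mul_besselK`). Each factor is a Fourier integral over ℝ, so the product is
the integral of a convolution. Rotating the inner contour turns it into a double integral of
e^{2iτr} exp(−4x^{1/4} √(cosh r) cosh q) (`kernel_eq_integral_integral`). This is a superposition of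
exponentials in y = 4x^{1/4}, and its Mellin transform separates into two beta integrals:
`hasMellin_kernel` gives 4^{−s−1} Γ(2s) Γ(s+iτ) Γ(s−iτ).

On Re s = γ one has |Γ(s+iτ)Γ(s−iτ)| ≤ B(γ,γ)|Γ(2s)|. Mellin inversion then bounds the kernel by
x^{−γ} C_γ uniformly in τ (`norm_kernel_le_constC`), which yields convergence, continuity and the
norm estimate.

For the identity, Fubini and Legendre duplication reduce the quotient to (8√π)⁻¹ ∫
Γ(1/2−s)Γ(s+iτ)Γ(s−iτ) g(τ) dτ (`mellinQuotient_eq_integral`). Up to the factor cosh(πτ)/√π, this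
gamma product is the Mellin transform of e^{y/2}K_{iτ}(y/2) for 0 < Re s < 1/2
(`hasMellin_cexp_mul_besselK`). Inverting it under the τ-integral finishes the proof; the exchange
is absolutely convergent because Γ(1/2−s) is integrable along the line. -/

/-! ### Double-exponential decay and rotation of the contour -/

open Real in
theorem one_add_sq_div_two_le_cosh (u : ℝ) : 1 + u ^ 2 / 2 ≤ cosh u := by
  have h := Real.hasSum_cosh u
  have h2 := sum_le_hasSum (Finset.range 2) (fun i _ => by rw [pow_mul]; positivity) h
  simpa [Finset.sum_range_succ] using h2

theorem integrable_exp_neg_mul_cosh {c : ℝ} (hc : 0 < c) :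
    Integrable (fun u : ℝ => Real.exp (-(c * Real.cosh u))) := by
  refine (integrable_exp_neg_mul_sq (half_pos hc)).mono' (by fun_prop) (.of_forall fun u => ?_)
  rw [Real.norm_of_nonneg (Real.exp_nonneg _)]
  refine Real.exp_le_exp.2 ?_
  nlinarith [one_add_sq_div_two_le_cosh u]

/-- Half of the exponent absorbs the factor cosh u, because t ≤ e^t. The result dominates the
derivative in the rotation argument. -/
theorem integrable_cosh_mul_exp_neg_mul_cosh {c : ℝ} (hc : 0 < c) :
    Integrable (fun u : ℝ => Real.cosh u * Real.exp (-(c * Real.cosh u))) := by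
  refine ((integrable_exp_neg_mul_cosh (half_pos hc)).const_mul (2 / c)).mono' (by fun_prop)
    (.of_forall fun u => ?_)
  have h0 := (Real.cosh_pos u).le
  rw [Real.norm_of_nonneg (by positivity)]
  have h1 : c / 2 * Real.cosh u ≤ Real.exp (c / 2 * Real.cosh u) := by
    linarith [Real.add_one_le_exp (c / 2 * Real.cosh u)]
  have h2 : Real.exp (-(c * Real.cosh u)) =
      Real.exp (-(c / 2 * Real.cosh u)) * Real.exp (-(c / 2 * Real.cosh u)) := by
    rw [← Real.exp_add]; ring_nf
  have h3 : Real.exp (c / 2 * Real.cosh u) * Real.exp (-(c / 2 * Real.cosh u)) = 1 := by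
    rw [← Real.exp_add]; simp
  have h4 := Real.exp_pos (-(c / 2 * Real.cosh u))
  have h5 : Real.cosh u * Real.exp (-(c / 2 * Real.cosh u)) ≤ 2 / c := by
    rw [le_div_iff₀ hc]
    nlinarith [mul_le_mul_of_nonneg_right h1 h4.le]
  rw [h2, ← mul_assoc]
  exact mul_le_mul_of_nonneg_right h5 h4.le

theorem re_cosh_add_mul_I (q θ : ℝ) :
    (Complex.cosh (q + θ * Complex.I)).re = Real.cosh q * Real.cos θ := by
  rw [Complex.cosh_add, Complex.cosh_mul_I, Complex.sinh_mul_I, ← Complex.ofReal_cosh,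
    ← Complex.ofReal_sinh, ← Complex.ofReal_cos, ← Complex.ofReal_sin]
  simp [Complex.cos_ofReal_re]

theorem norm_sinh_add_mul_I_le (q θ : ℝ) :
    ‖Complex.sinh (q + θ * Complex.I)‖ ≤ Real.cosh q := by
  rw [Complex.sinh, Real.cosh_eq]
  rw [norm_div]
  simp only [Complex.norm_ofNat]
  gcongr
  refine (norm_sub_le _ _).trans ?_
  simp [Complex.norm_exp]

theorem norm_exp_neg_mul_cosh_add_mul_I (A q θ : ℝ) :
    ‖Complex.exp (-(A * Complex.cosh (q + θ * Complex.I)))‖ =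
      Real.exp (-(A * Real.cos θ * Real.cosh q)) := by
  rw [Complex.norm_exp, Complex.neg_re, Complex.re_ofReal_mul, re_cosh_add_mul_I]
  ring_nf

theorem continuous_exp_neg_mul_cosh_add_mul_I (A θ : ℝ) :
    Continuous (fun q : ℝ => Complex.exp (-(A * Complex.cosh (q + θ * Complex.I)))) :=
  Complex.continuous_exp.comp (continuous_const.mul (Complex.continuous_cosh.comp
    (Complex.continuous_ofReal.add continuous_const))).neg

theorem integrable_exp_neg_mul_cosh_add_mul_I {A θ : ℝ} (hA : 0 < A) (hθ : 0 < Real.cos θ) :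
    Integrable (fun q : ℝ => Complex.exp (-(A * Complex.cosh (q + θ * Complex.I)))) := by
  refine (integrable_exp_neg_mul_cosh (mul_pos hA hθ)).mono'
    (continuous_exp_neg_mul_cosh_add_mul_I A θ).aestronglyMeasurable (.of_forall fun q => ?_)
  rw [norm_exp_neg_mul_cosh_add_mul_I]

/-- Rotation of the line of integration. -/
theorem integral_exp_neg_mul_cosh_add_mul_I {A θ : ℝ} (hA : 0 < A)
    (hθ : θ ∈ Ioo (-(Real.pi / 2)) (Real.pi / 2)) :
    ∫ q : ℝ, Complex.exp (-(A * Complex.cosh (q + θ * Complex.I))) =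
      ∫ q : ℝ, Complex.exp (-(A * Complex.cosh q)) := by
  have key : ∀ θ ∈ Ioo (-(Real.pi / 2)) (Real.pi / 2),
      HasDerivAt (fun θ : ℝ => ∫ q : ℝ, Complex.exp (-(A * Complex.cosh (q + θ * Complex.I))))
        0 θ := by
    intro θ hθ
    have hcos : 0 < Real.cos θ := Real.cos_pos_of_mem_Ioo hθ
    -- Near θ the decay rate A cos φ stays above A cos θ / 2, which gives one majorant for all
    -- nearby angles.
    have hev : ∀ᶠ φ in nhds θ, Real.cos θ / 2 < Real.cos φ :=
      Real.continuous_cos.continuousAt.eventually (lt_mem_nhds (half_lt_self hcos))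
    set F' : ℝ → ℝ → ℂ := fun φ q => Complex.exp (-(A * Complex.cosh (q + φ * Complex.I))) *
      (-(A * (Complex.sinh (q + φ * Complex.I) * Complex.I))) with hF'
    have hbound : ∀ φ q : ℝ, Real.cos θ / 2 < Real.cos φ → ‖F' φ q‖ ≤
        A * (Real.cosh q * Real.exp (-(A * (Real.cos θ / 2) * Real.cosh q))) := by
      intro φ q hφ
      rw [hF']
      simp only [norm_mul, norm_neg, Complex.norm_I, mul_one, Complex.norm_real,
        Real.norm_of_nonneg hA.le]
      rw [norm_exp_neg_mul_cosh_add_mul_I]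
      have h1 := norm_sinh_add_mul_I_le q φ
      have h0 := (Real.cosh_pos q)
      calc _ ≤ Real.exp (-(A * (Real.cos θ / 2) * Real.cosh q)) * (A * Real.cosh q) := by
            gcongr
        _ = _ := by ring
    have hbi : Integrable fun q : ℝ =>
        A * (Real.cosh q * Real.exp (-(A * (Real.cos θ / 2) * Real.cosh q))) :=
      (integrable_cosh_mul_exp_neg_mul_cosh (mul_pos hA (half_pos hcos))).const_mul A
    have hmeas : ∀ φ : ℝ, AEStronglyMeasurable (F' φ) := fun φ => by
      refine Continuous.aestronglyMeasurable ?_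
      refine (continuous_exp_neg_mul_cosh_add_mul_I A φ).mul (Continuous.neg ?_)
      refine continuous_const.mul (Continuous.mul (Complex.continuous_sinh.comp ?_)
        continuous_const)
      fun_prop
    have hd := (hasDerivAt_integral_of_dominated_loc_of_deriv_le (μ := volume) (𝕜 := ℝ)
      (F := fun (φ : ℝ) (q : ℝ) => Complex.exp (-(A * Complex.cosh (q + φ * Complex.I))))
      (F' := F') (x₀ := θ) (s := {φ | Real.cos θ / 2 < Real.cos φ})
      (bound := fun q => A * (Real.cosh q * Real.exp (-(A * (Real.cos θ / 2) * Real.cosh q))))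
      hev (.of_forall fun φ => (continuous_exp_neg_mul_cosh_add_mul_I A φ).aestronglyMeasurable)
      (integrable_exp_neg_mul_cosh_add_mul_I hA hcos) (hmeas θ)
      (.of_forall fun q φ hφ => hbound φ q hφ) hbi
      (.of_forall fun q φ hφ => by
        have h1 : HasDerivAt (fun φ : ℝ => (q : ℂ) + φ * Complex.I) Complex.I φ := by
          simpa using ((Complex.ofRealCLM.hasDerivAt (x := φ)).mul_const Complex.I).const_add
            (q : ℂ)
        exact ((((Complex.hasDerivAt_cosh _).comp φ h1).const_mul (A : ℂ)).fun_neg).cexp)).2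
    -- The integrand depends on q + iθ only, so its θ-derivative is i times its q-derivative, and
    -- the latter integrates to zero over ℝ.
    have hz : ∫ q : ℝ, F' θ q = 0 := by
      have h2 : ∀ q : ℝ, HasDerivAt (fun q : ℝ => Complex.I *
          Complex.exp (-(A * Complex.cosh (q + θ * Complex.I)))) (F' θ q) q := by
        intro q
        have h1 : HasDerivAt (fun q : ℝ => (q : ℂ) + θ * Complex.I) 1 q := by
          simpa using (Complex.ofRealCLM.hasDerivAt (x := q)).add_const ((θ : ℂ) * Complex.I)
        refine (((((Complex.hasDerivAt_cosh _).comp q h1).const_mul (A : ℂ)).fun_neg.cexp).const_mul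
          Complex.I).congr_deriv ?_
        simp only [hF', Function.comp]
        ring
      exact integral_eq_zero_of_hasDerivAt_of_integrable h2
        (hbi.mono' (hmeas θ) (.of_forall fun q => hbound θ q (half_lt_self hcos)))
        ((integrable_exp_neg_mul_cosh_add_mul_I hA hcos).const_mul _)
    rwa [hz] at hd
  have h0 : (0 : ℝ) ∈ Ioo (-(Real.pi / 2)) (Real.pi / 2) := by
    constructor <;> linarith [Real.pi_pos]
  have := isOpen_Ioo.is_const_of_deriv_eq_zero isPreconnected_Ioo
    (fun x hx => (key x hx).differentiableAt.differentiableWithinAt)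
    (fun x hx => (key x hx).deriv) hθ h0
  simpa using this

/-- With R = √(a² + b²) and θ = arctan(b/a), the exponent a cosh q + i b sinh q equals R cosh(q +
iθ). Since a > 0, the angle lies in the range where rotation is allowed. -/
theorem integral_exp_neg_cosh_add_sinh {a b : ℝ} (ha : 0 < a) :
    ∫ q : ℝ, Complex.exp (-(a * Complex.cosh q + b * Complex.sinh q * Complex.I)) =
      ∫ q : ℝ, Complex.exp (-(√(a ^ 2 + b ^ 2) * Complex.cosh q)) := by
  have hR : 0 < √(a ^ 2 + b ^ 2) := Real.sqrt_pos.2 (by positivity)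
  have hRa : √(a ^ 2 + b ^ 2) = a * √(1 + (b / a) ^ 2) := by
    rw [show a ^ 2 + b ^ 2 = a ^ 2 * (1 + (b / a) ^ 2) by field_simp,
      Real.sqrt_mul (by positivity), Real.sqrt_sq ha.le]
  have hs : 0 < √(1 + (b / a) ^ 2) := Real.sqrt_pos.2 (by positivity)
  rw [← integral_exp_neg_mul_cosh_add_mul_I hR (θ := Real.arctan (b / a))
    ⟨Real.neg_pi_div_two_lt_arctan _, Real.arctan_lt_pi_div_two _⟩]
  congr 1
  ext q
  have hc : √(a ^ 2 + b ^ 2) * Real.cos (Real.arctan (b / a)) = a := by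
    rw [hRa, Real.cos_arctan]; field_simp
  have hsn : √(a ^ 2 + b ^ 2) * Real.sin (Real.arctan (b / a)) = b := by
    rw [hRa, Real.sin_arctan]; field_simp
  rw [Complex.cosh_add, Complex.cosh_mul_I, Complex.sinh_mul_I, ← Complex.ofReal_cos,
    ← Complex.ofReal_sin]
  nth_rewrite 1 [← hc]
  nth_rewrite 3 [← hsn]
  push_cast
  ring_nf

/-! ### The Macdonald function of imaginary order -/

theorem cosh_I_mul_mul (τ u : ℝ) :
    Complex.cosh (Complex.I * τ * u) = (Real.cos (τ * u) : ℝ) := by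
  rw [show Complex.I * τ * u = ((τ * u : ℝ) : ℂ) * Complex.I by push_cast; ring,
    Complex.cosh_mul_I, Complex.ofReal_cos]

theorem norm_exp_neg_mul_cosh (z : ℂ) (u : ℝ) :
    ‖Complex.exp (-z * Complex.cosh u)‖ = Real.exp (-(z.re * Real.cosh u)) := by
  rw [Complex.norm_exp, ← Complex.ofReal_cosh, Complex.re_mul_ofReal]
  simp

theorem continuous_exp_neg_mul_cosh (z : ℂ) :
    Continuous (fun u : ℝ => Complex.exp (-z * Complex.cosh u)) :=
  Complex.continuous_exp.comp (continuous_const.mul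
    (Complex.continuous_cosh.comp Complex.continuous_ofReal))

theorem continuous_cexp_I_mul (τ : ℝ) :
    Continuous (fun u : ℝ => Complex.exp (Complex.I * τ * u)) := by fun_prop

theorem norm_cexp_I_mul (τ u : ℝ) : ‖Complex.exp (Complex.I * τ * u)‖ = 1 := by
  rw [show Complex.I * τ * u = ((τ * u : ℝ) : ℂ) * Complex.I by push_cast; ring,
    Complex.norm_exp_ofReal_mul_I]

theorem integrable_exp_neg_mul_cosh_mul_cexp {z : ℂ} (hz : 0 < z.re) (τ : ℝ) :
    Integrable (fun u : ℝ =>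
      Complex.exp (-z * Complex.cosh u) * Complex.exp (Complex.I * τ * u)) := by
  refine (integrable_exp_neg_mul_cosh hz).mono'
    ((continuous_exp_neg_mul_cosh z).mul (continuous_cexp_I_mul τ)).aestronglyMeasurable
    (.of_forall fun u => ?_)
  rw [norm_mul, norm_exp_neg_mul_cosh, norm_cexp_I_mul, mul_one]

theorem integrable_besselK_integrand {z : ℂ} (hz : 0 < z.re) (τ : ℝ) :
    Integrable (fun u : ℝ =>
      Complex.exp (-z * Complex.cosh u) * Complex.cosh (Complex.I * τ * u)) := by
  refine (((integrable_exp_neg_mul_cosh_mul_cexp hz τ).add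
    (integrable_exp_neg_mul_cosh_mul_cexp hz (-τ))).div_const 2).congr (.of_forall fun u => ?_)
  simp only [Pi.add_apply, Complex.cosh]
  push_cast
  ring_nf

/-- `K_{iτ}(z)` as an integral over the whole line. -/
theorem besselK_eq_integral_cexp {z : ℂ} (hz : 0 < z.re) (τ : ℝ) :
    besselK (Complex.I * τ) z = (1 / 2) * ∫ u : ℝ,
      Complex.exp (-z * Complex.cosh u) * Complex.exp (Complex.I * τ * u) := by
  have hi := integrable_exp_neg_mul_cosh_mul_cexp hz τ
  have h1 := integral_add_compl (measurableSet_Ioi (a := (0 : ℝ))) hi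
  rw [compl_Ioi, ← neg_zero, ← integral_comp_neg_Ioi, neg_zero] at h1
  rw [← h1, ← integral_add hi.integrableOn, besselK, ← integral_const_mul]
  · refine setIntegral_congr_fun measurableSet_Ioi fun u _ => ?_
    simp only [Complex.ofReal_neg, Complex.cosh_neg]
    have h2 : Complex.cosh (Complex.I * τ * u) =
      (Complex.exp (Complex.I * τ * u) + Complex.exp (-(Complex.I * τ * u))) / 2 := rfl
    rw [h2, mul_neg]
    ring
  · refine (integrable_exp_neg_mul_cosh_mul_cexp hz (-τ)).integrableOn.congr
      (.of_forall fun u => ?_)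
    simp only [Complex.ofReal_neg, Complex.cosh_neg]
    ring_nf

theorem norm_besselK_le {z : ℂ} (hz : 0 < z.re) (τ : ℝ) :
    ‖besselK (Complex.I * τ) z‖ ≤ ∫ u in Ioi (0 : ℝ), Real.exp (-(z.re * Real.cosh u)) := by
  refine norm_integral_le_of_norm_le (integrable_exp_neg_mul_cosh hz).integrableOn
    (.of_forall fun u => ?_)
  rw [norm_mul, norm_exp_neg_mul_cosh, cosh_I_mul_mul, Complex.norm_real]
  exact mul_le_of_le_one_right (Real.exp_nonneg _) (Real.abs_cos_le_one _)

/-- Joint continuity serves both the measurability needed for Fubini and the pointwise continuity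
needed for Mellin inversion. -/
theorem continuousAt_besselK (τ : ℝ) {z : ℂ} (hz : 0 < z.re) :
    ContinuousAt (fun p : ℝ × ℂ => besselK (Complex.I * p.1) p.2) (τ, z) := by
  have hev : ∀ᶠ p : ℝ × ℂ in nhds (τ, z), z.re / 2 < p.2.re :=
    (Complex.continuous_re.comp continuous_snd).continuousAt.eventually
      (lt_mem_nhds (half_lt_self hz))
  refine continuousAt_of_dominated
    (bound := fun u => Real.exp (-(z.re / 2 * Real.cosh u))) ?_ ?_ ?_ ?_
  · filter_upwards [hev] with p hp
    exact (integrable_besselK_integrand ((half_pos hz).trans hp)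
      p.1).integrableOn.aestronglyMeasurable
  · filter_upwards [hev] with p hp
    refine .of_forall fun u => ?_
    rw [norm_mul, norm_exp_neg_mul_cosh, cosh_I_mul_mul, Complex.norm_real]
    refine (mul_le_of_le_one_right (Real.exp_nonneg _) (Real.abs_cos_le_one _)).trans ?_
    have := Real.cosh_pos u
    gcongr
  · exact (integrable_exp_neg_mul_cosh (half_pos hz)).integrableOn
  · refine .of_forall fun u => Continuous.continuousAt ?_
    exact (Complex.continuous_exp.comp (continuous_snd.neg.mul continuous_const)).mul
      (Complex.continuous_cosh.comp (by fun_prop))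

/-! ### The kernel as a double integral -/

/-- The argument `2 (4 x)^{1/4}` of the Kelvin functions. -/
noncomputable def kelvinArg (x : ℝ) : ℝ := 2 * (4 * x) ^ (1 / 4 : ℝ)

theorem kelvinArg_pos {x : ℝ} (hx : 0 < x) : 0 < kelvinArg x := by
  unfold kelvinArg; positivity

theorem sqrt_two_mul_kelvinArg {x : ℝ} (hx : 0 < x) :
    √2 * kelvinArg x = 4 * x ^ (1 / 4 : ℝ) := by
  have h4 : (4 : ℝ) ^ (1 / 4 : ℝ) = √2 := by
    rw [show (4 : ℝ) = 2 ^ (2 : ℝ) by norm_num, ← Real.rpow_mul (by norm_num), Real.sqrt_eq_rpow]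
    norm_num
  rw [kelvinArg, Real.mul_rpow (by norm_num) hx.le, h4]
  have := Real.mul_self_sqrt (show (0 : ℝ) ≤ 2 by norm_num)
  linear_combination (2 * x ^ (1 / 4 : ℝ)) * this

theorem cexp_pi_div_four : Complex.exp (Real.pi * Complex.I / 4) =
    ((√2 / 2 : ℝ) : ℂ) + ((√2 / 2 : ℝ) : ℂ) * Complex.I := by
  rw [show (Real.pi * Complex.I / 4 : ℂ) = ((Real.pi / 4 : ℝ) : ℂ) * Complex.I by push_cast; ring,
    Complex.exp_mul_I, ← Complex.ofReal_cos, ← Complex.ofReal_sin, Real.cos_pi_div_four,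
    Real.sin_pi_div_four]

theorem cexp_neg_pi_div_four : Complex.exp (-(Real.pi * Complex.I / 4)) =
    ((√2 / 2 : ℝ) : ℂ) - ((√2 / 2 : ℝ) : ℂ) * Complex.I := by
  rw [show (-(Real.pi * Complex.I / 4) : ℂ) = ((-(Real.pi / 4) : ℝ) : ℂ) * Complex.I by
    push_cast; ring, Complex.exp_mul_I, ← Complex.ofReal_cos, ← Complex.ofReal_sin, Real.cos_neg,
    Real.sin_neg, Real.cos_pi_div_four, Real.sin_pi_div_four]
  push_cast
  ring

/-- The sum of squares factors over ℂ, and the prefactors e^{∓νπi/2} cancel in the product. -/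
theorem kernel_eq_besselK_mul_besselK (x τ : ℝ) :
    kernel x τ =
      besselK (Complex.I * (2 * τ : ℝ)) (kelvinArg x * Complex.exp (Real.pi * Complex.I / 4)) *
      besselK (Complex.I * (2 * τ : ℝ)) (kelvinArg x * Complex.exp (-(Real.pi * Complex.I / 4))) := by
  have h : kernel x τ = kelvinPlus (2 * Complex.I * τ) (kelvinArg x) *
      kelvinMinus (2 * Complex.I * τ) (kelvinArg x) := by
    simp only [kernel, kelvinKer, kelvinKei, kelvinArg]
    rw [div_pow _ (2 * Complex.I), mul_pow, Complex.I_sq]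
    ring
  have e : Complex.exp (-(2 * Complex.I * τ * Real.pi * Complex.I / 2)) *
      Complex.exp (2 * Complex.I * τ * Real.pi * Complex.I / 2) = 1 := by
    rw [← Complex.exp_add, neg_add_cancel, Complex.exp_zero]
  have hν : (2 * Complex.I * τ : ℂ) = Complex.I * (2 * τ : ℝ) := by push_cast; ring
  rw [h, kelvinPlus, kelvinMinus, mul_mul_mul_comm, e, one_mul, hν]

theorem re_mul_cexp_pi_div_four (X : ℝ) :
    ((X : ℂ) * Complex.exp (Real.pi * Complex.I / 4)).re = X * (√2 / 2) := by
  rw [cexp_pi_div_four, Complex.re_ofReal_mul]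
  simp

theorem re_mul_cexp_neg_pi_div_four (X : ℝ) :
    ((X : ℂ) * Complex.exp (-(Real.pi * Complex.I / 4))).re = X * (√2 / 2) := by
  rw [cexp_neg_pi_div_four, Complex.re_ofReal_mul]
  simp

theorem continuousOn_kernel :
    ContinuousOn (fun p : ℝ × ℝ => kernel p.1 p.2) (Ioi 0 ×ˢ univ) := by
  rintro ⟨x, τ⟩ ⟨hx, -⟩
  have hX := kelvinArg_pos (mem_Ioi.1 hx)
  simp_rw [kernel_eq_besselK_mul_besselK]
  have hc : ContinuousAt (fun p : ℝ × ℝ => kelvinArg p.1) (x, τ) := by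
    unfold kelvinArg
    have : (4 * x : ℝ) ≠ 0 := (mul_pos four_pos (mem_Ioi.1 hx)).ne'
    have h1 : ContinuousAt (fun p : ℝ × ℝ => 4 * p.1) (x, τ) := by fun_prop
    exact (h1.rpow_const (.inl this)).const_mul 2
  have hc' : ContinuousAt (fun p : ℝ × ℝ => (kelvinArg p.1 : ℂ)) (x, τ) :=
    Complex.continuous_ofReal.continuousAt.comp hc
  have h2 : ContinuousAt (fun p : ℝ × ℝ => 2 * p.2) (x, τ) := by fun_prop
  refine ContinuousAt.continuousWithinAt (.mul ?_ ?_)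
  · refine ContinuousAt.comp (f := fun p : ℝ × ℝ => ((2 * p.2 : ℝ),
      (kelvinArg p.1 * Complex.exp (Real.pi * Complex.I / 4) : ℂ)))
      (g := fun p : ℝ × ℂ => besselK (Complex.I * p.1) p.2) (x := (x, τ))
      (continuousAt_besselK _ ?_) (h2.prodMk (hc'.mul_const _))
    rw [re_mul_cexp_pi_div_four]; positivity
  · refine ContinuousAt.comp (f := fun p : ℝ × ℝ => ((2 * p.2 : ℝ),
      (kelvinArg p.1 * Complex.exp (-(Real.pi * Complex.I / 4)) : ℂ)))
      (g := fun p : ℝ × ℂ => besselK (Complex.I * p.1) p.2) (x := (x, τ))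
      (continuousAt_besselK _ ?_) (h2.prodMk (hc'.mul_const _))
    rw [re_mul_cexp_neg_pi_div_four]; positivity

open scoped Convolution in
/-- A product formula of Macdonald type. -/
theorem kernel_eq_integral_integral {x : ℝ} (hx : 0 < x) (τ : ℝ) :
    kernel x τ = (1 / 4) * ∫ r : ℝ, ∫ q : ℝ, Complex.exp (Complex.I * (2 * τ : ℝ) * r) *
      Complex.exp (-((4 * x ^ (1 / 4 : ℝ) * √(Real.cosh r) : ℝ) * Complex.cosh q)) := by
  have hX := kelvinArg_pos hx
  set X := kelvinArg x with hXdef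
  set z : ℂ := X * Complex.exp (Real.pi * Complex.I / 4) with hz
  set w : ℂ := X * Complex.exp (-(Real.pi * Complex.I / 4)) with hw
  have hzr : 0 < z.re := by rw [hz, re_mul_cexp_pi_div_four]; positivity
  have hwr : 0 < w.re := by rw [hw, re_mul_cexp_neg_pi_div_four]; positivity
  rw [kernel_eq_besselK_mul_besselK, ← hXdef, ← hz, ← hw, besselK_eq_integral_cexp hzr,
    besselK_eq_integral_cexp hwr]
  -- The product of the two line integrals is the integral of the convolution; its outer variable r
  -- is the sum of the two original ones.
  have hconv := integral_convolution (ContinuousLinearMap.mul ℂ ℂ)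
    (integrable_exp_neg_mul_cosh_mul_cexp hzr (2 * τ))
    (integrable_exp_neg_mul_cosh_mul_cexp hwr (2 * τ))
  simp only [ContinuousLinearMap.mul_apply'] at hconv
  rw [mul_mul_mul_comm, ← hconv, show (1 / 2 * (1 / 2) : ℂ) = 1 / 4 by norm_num]
  congr 1
  refine integral_congr_ae (.of_forall fun r => ?_)
  simp only [convolution_def, ContinuousLinearMap.mul_apply']
  -- Recentring makes the two arguments r/2 + q and r/2 − q, so the addition formulas leave only
  -- cosh(r/2) cosh q and i sinh(r/2) sinh q.
  rw [← integral_add_right_eq_self _ (r / 2), integral_const_mul]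
  have hpt : ∀ q : ℝ, Complex.exp (-z * Complex.cosh ((q + r / 2 : ℝ) : ℂ)) *
      Complex.exp (Complex.I * (2 * τ : ℝ) * ((q + r / 2 : ℝ) : ℂ)) *
      (Complex.exp (-w * Complex.cosh ((r - (q + r / 2) : ℝ) : ℂ)) *
      Complex.exp (Complex.I * (2 * τ : ℝ) * ((r - (q + r / 2) : ℝ) : ℂ))) =
      Complex.exp (Complex.I * (2 * τ : ℝ) * r) *
      Complex.exp (-((√2 * X * Real.cosh (r / 2) : ℝ) * Complex.cosh q +
        (√2 * X * Real.sinh (r / 2) : ℝ) * Complex.sinh q * Complex.I)) := by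
    intro q
    rw [mul_mul_mul_comm, ← Complex.exp_add, ← Complex.exp_add, mul_comm]
    congr 1
    · congr 1; push_cast; ring
    · congr 1
      rw [hz, hw, cexp_pi_div_four, cexp_neg_pi_div_four,
        show ((r - (q + r / 2) : ℝ) : ℂ) = (r / 2 : ℂ) - q by push_cast; ring,
        Complex.ofReal_add, Complex.cosh_add, Complex.cosh_sub]
      push_cast
      ring
  simp_rw [hpt]
  rw [integral_const_mul, integral_exp_neg_cosh_add_sinh
    (by have := Real.cosh_pos (r / 2); positivity)]
  have hch : (√2 * X * Real.cosh (r / 2)) ^ 2 + (√2 * X * Real.sinh (r / 2)) ^ 2 =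
      (√2 * X) ^ 2 * Real.cosh r := by
    have : Real.cosh r = Real.cosh (r / 2) ^ 2 + Real.sinh (r / 2) ^ 2 := by
      rw [← Real.cosh_two_mul]; ring_nf
    rw [this]; ring
  rw [hch, Real.sqrt_mul (by positivity), Real.sqrt_sq (by positivity), hXdef,
    sqrt_two_mul_kelvinArg hx]

/-! ### Mellin transforms of superpositions, and beta integrals on the line -/

theorem one_div_ofReal_cpow {r : ℝ} (hr : 0 < r) (s : ℂ) :
    (1 / (r : ℂ)) ^ s = (r : ℂ) ^ (-s) := by
  rw [one_div, Complex.inv_cpow _ _ (by rw [Complex.arg_ofReal_of_nonneg hr.le]; positivity),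
    Complex.cpow_neg]

theorem integrableOn_cpow_mul_exp_neg_mul {s : ℂ} (hs : 0 < s.re) {r : ℝ} (hr : 0 < r) :
    IntegrableOn (fun x : ℝ => (x : ℂ) ^ (s - 1) * Complex.exp (-(r * x))) (Ioi 0) := by
  have h : IntegrableOn (fun x : ℝ => x ^ (s.re - 1) * Real.exp (-r * x ^ (1 : ℝ))) (Ioi 0) :=
    integrableOn_rpow_mul_exp_neg_mul_rpow (by linarith) one_pos hr
  refine Integrable.mono' h ?_ ?_
  · refine ContinuousOn.aestronglyMeasurable (fun x hx => ?_) measurableSet_Ioi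
    refine ContinuousAt.continuousWithinAt (.mul ?_ (by fun_prop))
    exact Complex.continuousAt_ofReal_cpow_const _ _ (.inr (ne_of_gt hx))
  · filter_upwards [ae_restrict_mem measurableSet_Ioi] with x hx
    rw [norm_mul, Complex.norm_cpow_eq_rpow_re_of_pos hx, Complex.norm_exp, Real.rpow_one]
    simp

/-- Mellin transform of a superposition of exponentials. -/
theorem hasMellin_integral_exp {α : Type*} [MeasurableSpace α] {μ : Measure α} [SFinite μ]
    {w : α → ℂ} {D : α → ℝ} (hw : AEStronglyMeasurable w μ) (hD : Measurable D)
    (hpos : ∀ᵐ a ∂μ, 0 < D a) {s : ℂ} (hs : 0 < s.re)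
    (hint : Integrable (fun a => w a * (D a : ℂ) ^ (-s)) μ) :
    HasMellin (fun x => ∫ a, w a * Complex.exp (-(D a * x)) ∂μ) s
      (Complex.Gamma s * ∫ a, w a * (D a : ℂ) ^ (-s) ∂μ) := by
  set F : ℝ → α → ℂ := fun x a => w a * ((x : ℂ) ^ (s - 1) * Complex.exp (-(D a * x))) with hF
  have hmeas : AEStronglyMeasurable (Function.uncurry F)
      ((volume.restrict (Ioi (0 : ℝ))).prod μ) := by
    refine AEStronglyMeasurable.mul hw.comp_snd ?_
    exact Measurable.aestronglyMeasurable (by fun_prop)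
  have hFint : Integrable (Function.uncurry F) ((volume.restrict (Ioi (0 : ℝ))).prod μ) := by
    refine (integrable_prod_iff' hmeas).2 ⟨?_, ?_⟩
    · filter_upwards [hpos] with a ha
      exact (integrableOn_cpow_mul_exp_neg_mul hs ha).const_mul (w a)
    -- The x-integral of the norm is Γ(Re s) |w| D^{−Re s}, so `hint` is exactly the absolute
    -- convergence that Fubini needs.
    · refine (hint.norm.const_mul (Real.Gamma s.re)).congr ?_
      filter_upwards [hpos] with a ha
      have h1 : ∀ x ∈ Ioi (0 : ℝ), ‖Function.uncurry F (x, a)‖ =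
          ‖w a‖ * (x ^ (s.re - 1) * Real.exp (-(D a * x))) := by
        intro x hx
        simp only [Function.uncurry, hF, norm_mul]
        rw [Complex.norm_cpow_eq_rpow_re_of_pos hx, Complex.norm_exp]
        simp
      rw [setIntegral_congr_fun measurableSet_Ioi h1, integral_const_mul,
        Real.integral_rpow_mul_exp_neg_mul_Ioi hs ha, norm_mul,
        Complex.norm_cpow_eq_rpow_re_of_pos ha, one_div, Real.inv_rpow ha.le, Complex.neg_re,
        Real.rpow_neg ha.le]
      ring
  have hpt : ∀ x : ℝ, (x : ℂ) ^ (s - 1) • ∫ a, w a * Complex.exp (-(D a * x)) ∂μ =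
      ∫ a, F x a ∂μ := by
    intro x
    rw [smul_eq_mul, ← integral_const_mul]
    simp only [hF]
    congr 1; ext a; ring
  refine ⟨?_, ?_⟩
  · refine hFint.integral_prod_left.congr (.of_forall fun x => ?_)
    exact (hpt x).symm
  · rw [mellin]
    simp_rw [hpt]
    rw [integral_integral_swap hFint, ← integral_const_mul]
    refine integral_congr_ae ?_
    filter_upwards [hpos] with a ha
    simp only [hF]
    rw [integral_const_mul, Complex.integral_cpow_mul_exp_neg_mul_Ioi hs ha,
      one_div_ofReal_cpow ha]
    ring

/-- Substitute t = σ(x): the Jacobian σ(1 − σ) raises both exponents u − 1 and v − 1 by one. -/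
theorem betaIntegral_eq_integral_sigmoid {u v : ℂ} (hu : 0 < u.re) (hv : 0 < v.re) :
    Integrable (fun x : ℝ => (Real.sigmoid x : ℂ) ^ u * ((1 - Real.sigmoid x : ℝ) : ℂ) ^ v) ∧
    ∫ x : ℝ, (Real.sigmoid x : ℂ) ^ u * ((1 - Real.sigmoid x : ℝ) : ℂ) ^ v =
      Complex.betaIntegral u v := by
  have hd : ∀ x ∈ (univ : Set ℝ), HasDerivWithinAt Real.sigmoid
      (Real.sigmoid x * (1 - Real.sigmoid x)) univ x :=
    fun x _ => (Real.hasDerivAt_sigmoid x).hasDerivWithinAt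
  have hinj : InjOn Real.sigmoid univ := Real.sigmoid_injective.injOn
  have hpt : ∀ x : ℝ, |Real.sigmoid x * (1 - Real.sigmoid x)| •
      ((Real.sigmoid x : ℂ) ^ (u - 1) * (1 - (Real.sigmoid x : ℂ)) ^ (v - 1)) =
      (Real.sigmoid x : ℂ) ^ u * ((1 - Real.sigmoid x : ℝ) : ℂ) ^ v := by
    intro x
    have h0 := Real.sigmoid_pos x
    have h1 : 0 < 1 - Real.sigmoid x := sub_pos.2 (Real.sigmoid_lt_one x)
    rw [abs_of_pos (mul_pos h0 h1), Complex.real_smul, ← Complex.ofReal_one, ← Complex.ofReal_sub,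
      Complex.ofReal_one, Complex.cpow_sub _ _ (by exact_mod_cast h0.ne'),
      Complex.cpow_sub _ _ (by exact_mod_cast h1.ne'), Complex.cpow_one, Complex.cpow_one]
    have h0' : (Real.sigmoid x : ℂ) ≠ 0 := by exact_mod_cast h0.ne'
    have h1' : ((1 - Real.sigmoid x : ℝ) : ℂ) ≠ 0 := by exact_mod_cast h1.ne'
    rw [Complex.ofReal_mul]
    field_simp
  have hi := Complex.betaIntegral_convergent hu hv
  rw [intervalIntegrable_iff_integrableOn_Ioo_of_le zero_le_one, ← Real.range_sigmoid,
    ← image_univ, integrableOn_image_iff_integrableOn_abs_deriv_smul .univ hd hinj,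
    integrableOn_univ] at hi
  simp_rw [hpt] at hi
  refine ⟨hi, ?_⟩
  rw [Complex.betaIntegral, intervalIntegral.integral_of_le zero_le_one,
    integral_Ioc_eq_integral_Ioo, ← Real.range_sigmoid, ← image_univ,
    integral_image_eq_integral_abs_deriv_smul .univ hd hinj, setIntegral_univ]
  simp_rw [hpt]

theorem ofReal_cpow_eq_cexp {r : ℝ} (hr : 0 < r) (u : ℂ) :
    (r : ℂ) ^ u = Complex.exp (Real.log r * u) := by
  rw [Complex.cpow_def_of_ne_zero (by exact_mod_cast hr.ne'), Complex.ofReal_log hr.le]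

/-- Here σ(2q) = e^q / (2 cosh q) and 1 − σ(2q) = e^{−q} / (2 cosh q). -/
theorem sigmoid_cpow_mul_one_sub_sigmoid_cpow (s : ℂ) (τ q : ℝ) :
    (Real.sigmoid (q * 2) : ℂ) ^ (s + Complex.I * τ) *
      ((1 - Real.sigmoid (q * 2) : ℝ) : ℂ) ^ (s - Complex.I * τ) =
    2 ^ (-(2 * s)) *
      (Complex.exp (Complex.I * (2 * τ : ℝ) * q) * (Real.cosh q : ℂ) ^ (-(2 * s))) := by
  have hc := Real.cosh_pos q
  have hsig : ∀ q : ℝ, Real.sigmoid (q * 2) = Real.exp q / (2 * Real.cosh q) := by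
    intro q
    rw [Real.sigmoid_def, Real.cosh_eq]
    have h : Real.exp (-(q * 2)) = Real.exp (-q) * Real.exp (-q) := by
      rw [← Real.exp_add]; ring_nf
    have h2 : Real.exp q * Real.exp (-q) = 1 := by rw [← Real.exp_add]; simp
    have := Real.exp_pos (-q)
    have := Real.exp_pos q
    rw [h]
    field_simp
    linear_combination (-Real.exp (-q)) * h2
  have hlog : ∀ q : ℝ, Real.log (Real.sigmoid (q * 2)) = q - (Real.log 2 + Real.log (Real.cosh q)) := by
    intro q
    have hc := Real.cosh_pos q
    rw [hsig, Real.log_div (Real.exp_ne_zero _) (by positivity), Real.log_exp,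
      Real.log_mul two_ne_zero hc.ne']
  have h1 : 1 - Real.sigmoid (q * 2) = Real.sigmoid (-q * 2) := by
    rw [← Real.sigmoid_neg]; ring_nf
  rw [h1, ofReal_cpow_eq_cexp (Real.sigmoid_pos _), ofReal_cpow_eq_cexp (Real.sigmoid_pos _),
    ofReal_cpow_eq_cexp hc, hlog, hlog, Real.cosh_neg, ← Complex.ofReal_ofNat 2,
    ofReal_cpow_eq_cexp two_pos]
  simp only [← Complex.exp_add]
  push_cast
  ring_nf

/-- The Fourier transform of a power of the hyperbolic cosine. -/
theorem integral_cexp_mul_cosh_cpow {s : ℂ} (hs : 0 < s.re) (τ : ℝ) :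
    Integrable (fun q : ℝ => Complex.exp (Complex.I * (2 * τ : ℝ) * q) *
      (Real.cosh q : ℂ) ^ (-(2 * s))) ∧
    ∫ q : ℝ, Complex.exp (Complex.I * (2 * τ : ℝ) * q) * (Real.cosh q : ℂ) ^ (-(2 * s)) =
      2 ^ (2 * s - 1) * (Complex.Gamma (s + Complex.I * τ) * Complex.Gamma (s - Complex.I * τ) /
        Complex.Gamma (2 * s)) := by
  have hu : 0 < (s + Complex.I * τ).re := by simpa using hs
  have hv : 0 < (s - Complex.I * τ).re := by simpa using hs
  obtain ⟨hi, he⟩ := betaIntegral_eq_integral_sigmoid hu hv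
  have h2 : (2 : ℂ) ^ (-(2 * s)) ≠ 0 := by simp [Complex.cpow_eq_zero_iff]
  have hi2 := hi.comp_mul_right' (R := 2) two_ne_zero
  have he2 := Measure.integral_comp_mul_right (fun x : ℝ =>
    (Real.sigmoid x : ℂ) ^ (s + Complex.I * τ) *
      ((1 - Real.sigmoid x : ℝ) : ℂ) ^ (s - Complex.I * τ)) 2
  simp_rw [sigmoid_cpow_mul_one_sub_sigmoid_cpow] at hi2 he2
  rw [integral_const_mul, he, Complex.betaIntegral_eq_Gamma_mul_div _ _ hu hv] at he2
  refine ⟨?_, ?_⟩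
  · refine (hi2.const_mul (2 ^ (-(2 * s)))⁻¹).congr (.of_forall fun q => ?_)
    simp only
    rw [inv_mul_cancel_left₀ h2]
  · rw [← mul_right_inj' h2, he2, Complex.cpow_sub _ _ two_ne_zero, Complex.cpow_one,
      Complex.cpow_neg, Complex.real_smul, abs_of_pos (by norm_num),
      show s + Complex.I * τ + (s - Complex.I * τ) = 2 * s by ring]
    have h3 : (2 : ℂ) ^ (2 * s) ≠ 0 := by simp [Complex.cpow_eq_zero_iff]
    push_cast
    field_simp

/-! ### The Mellin transform of the kernel -/

/-- The variables separate. The trivial exponential with frequency 0 puts the q-factor in the form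
of `integral_cexp_mul_cosh_cpow` at 2s. -/
theorem sqrt_cosh_mul_cosh_cpow (s : ℂ) (τ r q : ℝ) :
    (1 / 4) * Complex.exp (Complex.I * (2 * τ : ℝ) * r) *
      ((√(Real.cosh r) * Real.cosh q : ℝ) : ℂ) ^ (-(4 * s)) =
    (1 / 4) * ((Complex.exp (Complex.I * (2 * τ : ℝ) * r) * (Real.cosh r : ℂ) ^ (-(2 * s))) *
      (Complex.exp (Complex.I * (2 * (0 : ℝ) : ℝ) * q) *
        (Real.cosh q : ℂ) ^ (-(2 * (2 * s))))) := by
  have h1 := Real.cosh_pos r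
  have h2 := Real.cosh_pos q
  rw [ofReal_cpow_eq_cexp (by positivity), ofReal_cpow_eq_cexp h1, ofReal_cpow_eq_cexp h2,
    Real.log_mul (by positivity) h2.ne', Real.log_sqrt h1.le, mul_assoc]
  congr 1
  simp only [← Complex.exp_add]
  push_cast
  ring_nf

theorem measurable_sqrt_cosh_mul_cosh :
    Measurable (fun p : ℝ × ℝ => √(Real.cosh p.1) * Real.cosh p.2) := by fun_prop

theorem integrable_sqrt_cosh_mul_cosh_cpow {s : ℂ} (hs : 0 < s.re) (τ : ℝ) :
    Integrable (fun p : ℝ × ℝ => (1 / 4) * Complex.exp (Complex.I * (2 * τ : ℝ) * p.1) *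
      ((√(Real.cosh p.1) * Real.cosh p.2 : ℝ) : ℂ) ^ (-(4 * s))) := by
  simp_rw [sqrt_cosh_mul_cosh_cpow]
  exact ((integral_cexp_mul_cosh_cpow hs τ).1.mul_prod
    (integral_cexp_mul_cosh_cpow (s := 2 * s) (by simpa using hs) 0).1).const_mul _

/-- The r-integral contributes Γ(s+iτ)Γ(s−iτ)/Γ(2s) and the q-integral Γ(2s)²/Γ(4s), up to powers of
2; the outer Γ(4s) cancels and one Γ(2s) survives. -/
theorem integral_sqrt_cosh_mul_cosh_cpow {s : ℂ} (hs : 0 < s.re) (τ : ℝ) :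
    Complex.Gamma (4 * s) * ∫ p : ℝ × ℝ, (1 / 4) * Complex.exp (Complex.I * (2 * τ : ℝ) * p.1) *
      ((√(Real.cosh p.1) * Real.cosh p.2 : ℝ) : ℂ) ^ (-(4 * s)) =
    2 ^ (6 * s - 4) * (Complex.Gamma (2 * s) *
      (Complex.Gamma (s + Complex.I * τ) * Complex.Gamma (s - Complex.I * τ))) := by
  have hs2 : 0 < (2 * s).re := by simpa using hs
  have hs4 : 0 < (4 * s).re := by simpa using hs
  simp_rw [sqrt_cosh_mul_cosh_cpow]
  rw [integral_const_mul, Measure.volume_eq_prod, integral_prod_mul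
    (fun r : ℝ => Complex.exp (Complex.I * (2 * τ : ℝ) * r) * (Real.cosh r : ℂ) ^ (-(2 * s)))
    (fun q : ℝ => Complex.exp (Complex.I * (2 * (0 : ℝ) : ℝ) * q) *
        (Real.cosh q : ℂ) ^ (-(2 * (2 * s)))), (integral_cexp_mul_cosh_cpow hs τ).2,
    (integral_cexp_mul_cosh_cpow hs2 0).2, Complex.ofReal_zero, mul_zero, add_zero, sub_zero,
    show 6 * s - 4 = (2 * s - 1) + (2 * (2 * s) - 1) - 2 by ring,
    Complex.cpow_sub (_ + _) _ two_ne_zero, Complex.cpow_add _ _ two_ne_zero,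
    show (2 * (2 * s) : ℂ) = 4 * s by ring]
  have h1 := Complex.Gamma_ne_zero_of_re_pos hs2
  have h2 := Complex.Gamma_ne_zero_of_re_pos hs4
  rw [show (2 : ℂ) ^ (2 : ℂ) = 4 by norm_num]
  field_simp

theorem kernel_eq_integral_prod {x : ℝ} (hx : 0 < x) (τ : ℝ) :
    kernel x τ = ∫ p : ℝ × ℝ, (1 / 4) * Complex.exp (Complex.I * (2 * τ : ℝ) * p.1) *
      Complex.exp (-((√(Real.cosh p.1) * Real.cosh p.2 : ℝ) * (4 * x ^ (1 / 4 : ℝ) : ℝ))) := by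
  set y : ℝ := 4 * x ^ (1 / 4 : ℝ) with hy
  have hy0 : 0 < y := by positivity
  rw [kernel_eq_integral_integral hx, Measure.volume_eq_prod, integral_prod, ← integral_const_mul]
  · refine integral_congr_ae (.of_forall fun r => ?_)
    simp only
    rw [← integral_const_mul]
    refine integral_congr_ae (.of_forall fun q => ?_)
    simp only [← hy]
    rw [← mul_assoc]
    congr 2
    push_cast
    ring
  -- At s = 1/4 the power is D⁻¹ with D = √(cosh r) cosh q, and e^{−yD} ≤ (yD)⁻¹.
  · have hb := (integrable_sqrt_cosh_mul_cosh_cpow (s := 1 / 4) (by norm_num) τ).norm.const_mul y⁻¹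
    refine hb.mono' (Measurable.aestronglyMeasurable (by fun_prop)) (.of_forall fun p => ?_)
    have h1 := Real.cosh_pos p.1
    have h2 := Real.cosh_pos p.2
    have hD : 0 < √(Real.cosh p.1) * Real.cosh p.2 := by positivity
    rw [norm_mul, norm_mul (_ * _) (_ ^ _), Complex.norm_cpow_eq_rpow_re_of_pos hD,
      Complex.norm_exp (-_), mul_left_comm]
    refine mul_le_mul_of_nonneg_left ?_ (norm_nonneg _)
    rw [← Complex.ofReal_mul, ← Complex.ofReal_neg, Complex.ofReal_re]
    have : (-(4 * (1 / 4 : ℂ))).re = -1 := by norm_num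
    rw [this, Real.rpow_neg_one, ← mul_inv, Real.exp_neg, mul_comm y]
    refine inv_anti₀ (by positivity) ?_
    linarith [Real.add_one_le_exp (√(Real.cosh p.1) * Real.cosh p.2 * y)]

theorem hasMellin_kernel {s : ℂ} (hs : 0 < s.re) (τ : ℝ) :
    HasMellin (fun x => kernel x τ) s (4 ^ (-s - 1) * (Complex.Gamma (2 * s) *
      (Complex.Gamma (s + Complex.I * τ) * Complex.Gamma (s - Complex.I * τ)))) := by
  set Φ : ℝ → ℂ := fun y => ∫ p : ℝ × ℝ,
    (1 / 4) * Complex.exp (Complex.I * (2 * τ : ℝ) * p.1) *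
      Complex.exp (-((√(Real.cosh p.1) * Real.cosh p.2 : ℝ) * y)) with hΦ
  have hM : HasMellin Φ (4 * s) _ := hasMellin_integral_exp
    (Measurable.aestronglyMeasurable (by fun_prop)) measurable_sqrt_cosh_mul_cosh
    (.of_forall fun p => by
      have h1 := Real.cosh_pos p.1
      have h2 := Real.cosh_pos p.2
      positivity) (by simpa using hs) (integrable_sqrt_cosh_mul_cosh_cpow hs τ)
  rw [integral_sqrt_cosh_mul_cosh_cpow hs] at hM
  have hk : EqOn (fun x => kernel x τ) (fun x => Φ (4 * x ^ (1 / 4 : ℝ))) (Ioi 0) :=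
    fun x hx => kernel_eq_integral_prod hx τ
  -- The substitution y = 4x^{1/4} moves s to 4s and costs a factor 4 · 4^{−4s}; with 2^{6s−4} this
  -- leaves 4^{−s−1}.
  have e4 : (s / ((1 / 4 : ℝ) : ℂ)) = 4 * s := by push_cast; ring
  have hc : MellinConvergent (fun x => Φ (4 * x ^ (1 / 4 : ℝ))) s := by
    rw [MellinConvergent.comp_rpow (f := fun y => Φ (4 * y)) (by norm_num : (1 / 4 : ℝ) ≠ 0), e4,
      MellinConvergent.comp_mul_left four_pos]
    exact hM.1
  have hv : mellin (fun x => Φ (4 * x ^ (1 / 4 : ℝ))) s = 4 ^ (-s - 1) * (Complex.Gamma (2 * s) *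
      (Complex.Gamma (s + Complex.I * τ) * Complex.Gamma (s - Complex.I * τ))) := by
    rw [mellin_comp_rpow (fun y => Φ (4 * y)), e4, mellin_comp_mul_left _ _ four_pos, hM.2,
      smul_eq_mul, Complex.real_smul, ← mul_assoc, ← mul_assoc]
    congr 1
    rw [← Complex.ofReal_ofNat 4, ofReal_cpow_eq_cexp four_pos, ofReal_cpow_eq_cexp four_pos,
      ← Complex.ofReal_ofNat 2, ofReal_cpow_eq_cexp two_pos,
      show (4 : ℝ) = 2 ^ 2 by norm_num, Real.log_pow]
    have h2 : Complex.exp (Real.log 2) = 2 := by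
      rw [← Complex.ofReal_exp, Real.exp_log two_pos]; simp
    have h4 : ((|(1 / 2 ^ 2 : ℝ)|⁻¹ : ℝ) : ℂ) = Complex.exp (Real.log 2) ^ 2 := by
      rw [h2, abs_of_pos (by norm_num)]; norm_num
    rw [h4, ← Complex.exp_nat_mul, ← Complex.exp_add, ← Complex.exp_add]
    push_cast
    ring_nf
  refine ⟨?_, ?_⟩
  · refine (integrableOn_congr_fun (fun x hx => ?_) measurableSet_Ioi).1 hc
    simp only [hk hx]
  · rw [← hv]
    refine setIntegral_congr_fun measurableSet_Ioi fun x hx => ?_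
    simp only [hk hx]

/-- In the double integral τ enters only through a phase, and the rest of the integrand is positive.
-/
theorem norm_kernel_le {x : ℝ} (hx : 0 < x) (τ : ℝ) : ‖kernel x τ‖ ≤ ‖kernel x 0‖ := by
  have h0 : kernel x 0 = ((∫ p : ℝ × ℝ, (1 / 4) *
      Real.exp (-((√(Real.cosh p.1) * Real.cosh p.2) * (4 * x ^ (1 / 4 : ℝ)))) : ℝ) : ℂ) := by
    rw [kernel_eq_integral_prod hx, ← integral_complex_ofReal]
    refine integral_congr_ae (.of_forall fun p => ?_)
    simp
  rw [h0, Complex.norm_real, Real.norm_of_nonneg (by positivity), kernel_eq_integral_prod hx]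
  refine (norm_integral_le_integral_norm _).trans_eq ?_
  refine integral_congr_ae (.of_forall fun p => ?_)
  simp only [norm_mul, Complex.norm_exp]
  rw [← Complex.ofReal_mul, ← Complex.ofReal_neg, Complex.ofReal_re]
  norm_num

/-! ### The gamma function on vertical lines -/

theorem continuousAt_Gamma_of_re_pos {s : ℂ} (hs : 0 < s.re) : ContinuousAt Complex.Gamma s := by
  refine (Complex.differentiableAt_Gamma s fun m h => ?_).continuousAt
  rw [h] at hs
  simp only [Complex.neg_re, Complex.natCast_re] at hs
  linarith [m.cast_nonneg (α := ℝ)]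

theorem continuous_Gamma_comp {α : Type*} [TopologicalSpace α] {f : α → ℂ} (hf : Continuous f)
    (h : ∀ a, 0 < (f a).re) : Continuous (fun a => Complex.Gamma (f a)) :=
  continuous_iff_continuousAt.2 fun a =>
    (continuousAt_Gamma_of_re_pos (h a)).comp hf.continuousAt

theorem norm_Gamma_le_Gamma_re {s : ℂ} (hs : 0 < s.re) :
    ‖Complex.Gamma s‖ ≤ Real.Gamma s.re := by
  rw [Complex.Gamma_eq_integral hs, Real.Gamma_eq_integral hs, Complex.GammaIntegral]
  refine norm_integral_le_of_norm_le (Real.GammaIntegral_convergent hs) ?_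
  filter_upwards [ae_restrict_mem measurableSet_Ioi] with x hx
  rw [norm_mul, Complex.norm_cpow_eq_rpow_re_of_pos hx, Complex.norm_real,
    Real.norm_of_nonneg (Real.exp_nonneg _)]
  simp

/-- Two uses of the functional equation give |s||s+1||Γ(s)| = |Γ(s+2)| ≤ Γ(a+2), hence quadratic
decay in t. -/
theorem integrable_Gamma_vertical {a : ℝ} (ha : 0 < a) :
    Integrable (fun t : ℝ => Complex.Gamma (a + t * Complex.I)) := by
  refine (integrable_inv_one_add_sq.const_mul (Real.Gamma (a + 2) * (1 + (a ^ 2)⁻¹))).mono'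
    (continuous_Gamma_comp (by fun_prop) (by simpa using ha)).aestronglyMeasurable
    (.of_forall fun t => ?_)
  set s : ℂ := a + t * Complex.I with hs
  have hre : s.re = a := by simp [hs]
  have him : s.im = t := by simp [hs]
  have hs0 : s ≠ 0 := fun h => by rw [h] at hre; simp at hre; linarith
  have hs1 : s + 1 ≠ 0 := fun h => by
    have := congrArg Complex.re h
    simp [hre] at this; linarith
  have h1 : Complex.Gamma (s + 2) = (s + 1) * (s * Complex.Gamma s) := by
    rw [← Complex.Gamma_add_one s hs0, ← Complex.Gamma_add_one _ hs1]; ring_nf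
  have h2 : ‖s + 1‖ * (‖s‖ * ‖Complex.Gamma s‖) ≤ Real.Gamma (a + 2) := by
    rw [← norm_mul, ← norm_mul, ← h1]
    have := norm_Gamma_le_Gamma_re (s := s + 2) (by simp [hre]; linarith)
    simpa [hre] using this
  have h3 : ‖s‖ ^ 2 = a ^ 2 + t ^ 2 := by
    rw [Complex.sq_norm, Complex.normSq_apply, hre, him]; ring
  have h4 : ‖s‖ ≤ ‖s + 1‖ := by
    rw [← sq_le_sq₀ (norm_nonneg _) (norm_nonneg _), h3, Complex.sq_norm, Complex.normSq_apply]
    simp only [Complex.add_re, Complex.add_im, hre, him, Complex.one_re, Complex.one_im]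
    nlinarith
  have h5 : (a ^ 2 + t ^ 2) * ‖Complex.Gamma s‖ ≤ Real.Gamma (a + 2) := by
    rw [← h3]
    calc ‖s‖ ^ 2 * ‖Complex.Gamma s‖ = ‖s‖ * (‖s‖ * ‖Complex.Gamma s‖) := by ring
      _ ≤ _ := (mul_le_mul_of_nonneg_right h4 (by positivity)).trans h2
  have h6 : 1 + t ^ 2 ≤ (1 + (a ^ 2)⁻¹) * (a ^ 2 + t ^ 2) := by
    have : (1 + (a ^ 2)⁻¹) * (a ^ 2 + t ^ 2) = a ^ 2 + t ^ 2 + 1 + (a ^ 2)⁻¹ * t ^ 2 := by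
      field_simp; ring
    rw [this]
    have : 0 ≤ (a ^ 2)⁻¹ * t ^ 2 := by positivity
    nlinarith
  rw [← div_eq_mul_inv, le_div_iff₀ (by positivity)]
  calc ‖Complex.Gamma s‖ * (1 + t ^ 2)
      ≤ ‖Complex.Gamma s‖ * ((1 + (a ^ 2)⁻¹) * (a ^ 2 + t ^ 2)) := by gcongr
    _ = ((a ^ 2 + t ^ 2) * ‖Complex.Gamma s‖) * (1 + (a ^ 2)⁻¹) := by ring
    _ ≤ _ := by gcongr

theorem integrable_Gamma_two_mul_sq {γ : ℝ} (hγ : 0 < γ) :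
    Integrable (fun t : ℝ => Complex.Gamma (2 * ((γ : ℂ) + (t : ℂ) * Complex.I)) ^ 2) := by
  have h := (integrable_Gamma_vertical (a := 2 * γ) (by positivity)).comp_mul_left' (R := 2)
    two_ne_zero
  have he : ∀ t : ℝ, ((2 * γ : ℝ) : ℂ) + ((2 * t : ℝ) : ℂ) * Complex.I =
      2 * ((γ : ℂ) + (t : ℂ) * Complex.I) := by intro t; push_cast; ring
  simp_rw [he] at h
  refine (h.norm.const_mul (Real.Gamma (2 * γ))).mono' (h.aestronglyMeasurable.pow 2)
    (.of_forall fun t => ?_)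
  rw [norm_pow, sq]
  refine mul_le_mul_of_nonneg_right ?_ (norm_nonneg _)
  have hre : (2 * ((γ : ℂ) + (t : ℂ) * Complex.I)).re = 2 * γ := by simp
  have := norm_Gamma_le_Gamma_re (s := 2 * ((γ : ℂ) + (t : ℂ) * Complex.I))
    (by rw [hre]; positivity)
  rwa [hre] at this

/-! ### The kernel bound uniform in the index -/

/-- Taking absolute values inside the Fourier integral of (cosh q)^{−2s} removes τ and Im s; what
remains is the same integral at Re s and τ = 0, a beta function. -/
theorem norm_Gamma_mul_Gamma_le {s : ℂ} (hs : 0 < s.re) (τ : ℝ) :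
    ‖Complex.Gamma (s + Complex.I * τ) * Complex.Gamma (s - Complex.I * τ)‖ ≤
      ProbabilityTheory.beta s.re s.re * ‖Complex.Gamma (2 * s)‖ := by
  have h1 := (integral_cexp_mul_cosh_cpow hs τ).2
  have h2 := (integral_cexp_mul_cosh_cpow (s := (s.re : ℂ)) (by simpa using hs) 0).2
  have hs2 : 0 < (2 * s).re := by simpa using hs
  have hG : 0 < ‖Complex.Gamma (2 * s)‖ := norm_pos_iff.2 (Complex.Gamma_ne_zero_of_re_pos hs2)
  have h3 : ∫ q : ℝ, ‖Complex.exp (Complex.I * (2 * τ : ℝ) * q) *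
      (Real.cosh q : ℂ) ^ (-(2 * s))‖ = 2 ^ (2 * s.re - 1) * ProbabilityTheory.beta s.re s.re := by
    rw [← Complex.ofReal_inj, ← integral_complex_ofReal]
    have e : ∀ q : ℝ, ((‖Complex.exp (Complex.I * (2 * τ : ℝ) * q) *
        (Real.cosh q : ℂ) ^ (-(2 * s))‖ : ℝ) : ℂ) = Complex.exp (Complex.I * (2 * 0 : ℝ) * q) *
      (Real.cosh q : ℂ) ^ (-(2 * (s.re : ℂ))) := by
      intro q
      rw [norm_mul, norm_cexp_I_mul, Complex.norm_cpow_eq_rpow_re_of_pos (Real.cosh_pos q),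
        one_mul, Complex.ofReal_cpow (Real.cosh_pos q).le]
      simp
    simp_rw [e]
    rw [h2, ProbabilityTheory.beta]
    push_cast
    rw [Complex.ofReal_cpow two_pos.le, ← Complex.Gamma_ofReal, ← Complex.Gamma_ofReal]
    push_cast
    rw [mul_zero, add_zero, sub_zero, two_mul (s.re : ℂ)]
  have h4 := norm_integral_le_integral_norm (μ := volume) (fun q : ℝ =>
    Complex.exp (Complex.I * (2 * τ : ℝ) * q) * (Real.cosh q : ℂ) ^ (-(2 * s)))
  have h5 : ‖(2 : ℂ) ^ (2 * s - 1)‖ = 2 ^ (2 * s.re - 1) := by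
    rw [← Complex.ofReal_ofNat, Complex.norm_cpow_eq_rpow_re_of_pos two_pos]; simp
  rw [h1, h3, norm_mul, h5, norm_div] at h4
  have h6 := le_of_mul_le_mul_left h4 (by positivity)
  rwa [div_le_iff₀ hG] at h6

theorem norm_four_cpow (s : ℂ) : ‖(4 : ℂ) ^ (-s - 1)‖ = (4 : ℝ) ^ (-s.re) / 4 := by
  rw [← Complex.ofReal_ofNat, Complex.norm_cpow_eq_rpow_re_of_pos four_pos]
  simp only [Complex.sub_re, Complex.neg_re, Complex.one_re]
  rw [Real.rpow_sub_one (by norm_num)]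

theorem norm_mellin_kernel_le {s : ℂ} (hs : 0 < s.re) (τ : ℝ) :
    ‖mellin (fun x => kernel x τ) s‖ ≤
      (4 : ℝ) ^ (-s.re) / 4 * ProbabilityTheory.beta s.re s.re * ‖Complex.Gamma (2 * s) ^ 2‖ := by
  rw [(hasMellin_kernel hs τ).2, norm_mul, norm_four_cpow, norm_mul (Complex.Gamma _)]
  calc _ ≤ (4 : ℝ) ^ (-s.re) / 4 * (‖Complex.Gamma (2 * s)‖ *
        (ProbabilityTheory.beta s.re s.re * ‖Complex.Gamma (2 * s)‖)) := by
        gcongr; exact norm_Gamma_mul_Gamma_le hs τ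
    _ = _ := by rw [norm_pow]; ring

theorem verticalIntegrable_mellin_kernel {γ : ℝ} (hγ : 0 < γ) (τ : ℝ) :
    Complex.VerticalIntegrable (mellin fun x => kernel x τ) γ := by
  have hre : ∀ t : ℝ, ((γ : ℂ) + t * Complex.I).re = γ := by simp
  have hp : ∀ t : ℝ, 0 < ((γ : ℂ) + t * Complex.I).re := fun t => by rwa [hre]
  refine ((integrable_Gamma_two_mul_sq hγ).norm.const_mul
    ((4 : ℝ) ^ (-γ) / 4 * ProbabilityTheory.beta γ γ)).mono' ?_ (.of_forall fun t => ?_)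
  · simp_rw [fun t => (hasMellin_kernel (hp t) τ).2]
    refine Continuous.aestronglyMeasurable (.mul ?_ (.mul ?_ (.mul ?_ ?_)))
    · exact Continuous.const_cpow (by fun_prop) (.inl (by norm_num))
    all_goals exact continuous_Gamma_comp (by fun_prop) (by simpa using hγ)
  · have := norm_mellin_kernel_le (hp t) τ
    rwa [hre] at this

theorem continuousOn_kernel_left (τ : ℝ) : ContinuousOn (fun x => kernel x τ) (Ioi 0) :=
  continuousOn_kernel.comp (f := fun x : ℝ => (x, τ)) (by fun_prop) fun _ hx => ⟨hx, mem_univ _⟩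

theorem continuous_kernel_right {x : ℝ} (hx : 0 < x) : Continuous (fun τ => kernel x τ) := by
  rw [← continuousOn_univ]
  exact continuousOn_kernel.comp (f := fun τ : ℝ => (x, τ)) (by fun_prop)
    fun τ _ => ⟨hx, mem_univ _⟩

/-- Mellin inversion in x at fixed τ: the 1/(2π) of the inversion formula and the 4^{−γ}/4 of the
transform make up the prefactor of C_γ. -/
theorem norm_kernel_le_constC {γ : ℝ} (hγ : 0 < γ) {x : ℝ} (hx : 0 < x) (τ : ℝ) :
    ‖kernel x τ‖ ≤ x ^ (-γ) * constC γ := by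
  have hre : ∀ t : ℝ, ((γ : ℂ) + t * Complex.I).re = γ := by simp
  have hp : ∀ t : ℝ, 0 < ((γ : ℂ) + t * Complex.I).re := fun t => by rwa [hre]
  have h := mellinInv_mellin_eq γ (fun x => kernel x τ) hx
    (hasMellin_kernel (by simpa using hγ) τ).1 (verticalIntegrable_mellin_kernel hγ τ)
    ((continuousOn_kernel_left τ).continuousAt (Ioi_mem_nhds hx))
  rw [← h, mellinInv, norm_smul]
  have hb : ‖∫ t : ℝ, (x : ℂ) ^ (-((γ : ℂ) + t * Complex.I)) •
      mellin (fun x => kernel x τ) (γ + t * Complex.I)‖ ≤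
      ∫ t : ℝ, x ^ (-γ) * ((4 : ℝ) ^ (-γ) / 4 * ProbabilityTheory.beta γ γ) *
        ‖Complex.Gamma (2 * ((γ : ℂ) + (t : ℂ) * Complex.I)) ^ 2‖ := by
    refine norm_integral_le_of_norm_le ((integrable_Gamma_two_mul_sq hγ).norm.const_mul _)
      (.of_forall fun t => ?_)
    rw [norm_smul, Complex.norm_cpow_eq_rpow_re_of_pos hx, Complex.neg_re, hre, mul_assoc]
    have := norm_mellin_kernel_le (hp t) τ
    rw [hre] at this
    gcongr
  rw [integral_const_mul] at hb
  refine (mul_le_mul_of_nonneg_left hb (norm_nonneg _)).trans_eq ?_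
  rw [constC, Real.norm_of_nonneg (by positivity)]
  ring

theorem constC_nonneg {γ : ℝ} (hγ : 0 < γ) : 0 ≤ constC γ := by
  have := (ProbabilityTheory.beta_pos hγ hγ).le
  unfold constC
  positivity

/-! ### Convergence, continuity and boundedness of the index transform -/

theorem integrableOn_kernel_mul {γ : ℝ} (hγ : 0 < γ) {g : ℝ → ℂ} (hg : IntegrableOn g (Ioi 0))
    {x : ℝ} (hx : 0 < x) : IntegrableOn (fun τ => kernel x τ * g τ) (Ioi 0) :=
  hg.bdd_mul (continuous_kernel_right hx).aestronglyMeasurable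
    (.of_forall fun τ => norm_kernel_le_constC hγ hx τ)

theorem continuousOn_transformG {γ : ℝ} (hγ : 0 < γ) {g : ℝ → ℂ} (hg : IntegrableOn g (Ioi 0)) :
    ContinuousOn (transformG g) (Ioi 0) := by
  intro x hx
  rw [mem_Ioi] at hx
  -- Staying above x/2 keeps y^{−γ} bounded, so a multiple of |g| dominates.
  have hev : ∀ᶠ y in nhds x, x / 2 < y := lt_mem_nhds (half_lt_self hx)
  refine ContinuousAt.continuousWithinAt (continuousAt_of_dominated
    (bound := fun τ => (x / 2) ^ (-γ) * constC γ * ‖g τ‖) ?_ ?_ (hg.norm.const_mul _) ?_)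
  · filter_upwards [hev] with y hy
    exact (integrableOn_kernel_mul hγ hg ((half_pos hx).trans hy)).aestronglyMeasurable
  · filter_upwards [hev] with y hy
    refine .of_forall fun τ => ?_
    rw [norm_mul]
    have := constC_nonneg hγ
    refine mul_le_mul_of_nonneg_right
      ((norm_kernel_le_constC hγ ((half_pos hx).trans hy) τ).trans ?_) (norm_nonneg _)
    refine mul_le_mul_of_nonneg_right ?_ this
    exact Real.rpow_le_rpow_of_nonpos (half_pos hx) hy.le (by linarith)
  · exact .of_forall fun τ =>
      ((continuousOn_kernel_left τ).continuousAt (Ioi_mem_nhds hx)).mul continuousAt_const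

theorem norm_rpow_mul_transformG_le {γ : ℝ} (hγ : 0 < γ) {g : ℝ → ℂ}
    (hg : IntegrableOn g (Ioi 0)) {x : ℝ} (hx : 0 < x) :
    ‖((x ^ γ : ℝ) : ℂ) * transformG g x‖ ≤ constC γ * ∫ τ in Ioi (0 : ℝ), ‖g τ‖ := by
  have h : ‖transformG g x‖ ≤ ∫ τ in Ioi (0 : ℝ), x ^ (-γ) * constC γ * ‖g τ‖ := by
    refine norm_integral_le_of_norm_le (hg.norm.const_mul _) (.of_forall fun τ => ?_)
    rw [norm_mul]
    exact mul_le_mul_of_nonneg_right (norm_kernel_le_constC hγ hx τ) (norm_nonneg _)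
  rw [integral_const_mul] at h
  rw [norm_mul, Complex.norm_real, Real.norm_of_nonneg (by positivity)]
  refine (mul_le_mul_of_nonneg_left h (by positivity)).trans_eq ?_
  rw [← mul_assoc, ← mul_assoc, ← Real.rpow_add hx, add_neg_cancel, Real.rpow_zero, one_mul]

/-! ### The Mellin transform of the index transform -/

/-- Replacing τ by 0 in the kernel gives a majorant that is a product of a function of x and a
function of τ. -/
theorem integrable_kernel_mul_prod {g : ℝ → ℂ} (hg : IntegrableOn g (Ioi 0)) {s : ℂ}
    (hs : 0 < s.re) :
    Integrable (fun p : ℝ × ℝ => (p.1 : ℂ) ^ (s - 1) * (kernel p.1 p.2 * g p.2))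
      ((volume.restrict (Ioi 0)).prod (volume.restrict (Ioi 0))) := by
  have hk : IntegrableOn (fun x : ℝ => (x : ℂ) ^ (s - 1) * kernel x 0) (Ioi 0) :=
    (hasMellin_kernel hs 0).1
  refine (hk.mul_prod hg).norm.mono' ?_ ?_
  · refine .mul (Measurable.aestronglyMeasurable (by fun_prop)) (.mul ?_ hg.1.comp_snd)
    rw [Measure.prod_restrict]
    exact (continuousOn_kernel.mono (prod_mono_right (subset_univ _))).aestronglyMeasurable
      (measurableSet_Ioi.prod measurableSet_Ioi)
  · rw [Measure.prod_restrict]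
    filter_upwards [ae_restrict_mem (measurableSet_Ioi.prod measurableSet_Ioi)] with p hp
    rw [norm_mul, norm_mul, norm_mul, norm_mul, mul_assoc]
    gcongr
    exact norm_kernel_le hp.1 _

theorem mellin_transformG {g : ℝ → ℂ} (hg : IntegrableOn g (Ioi 0)) {s : ℂ} (hs : 0 < s.re) :
    mellin (transformG g) s = ∫ τ in Ioi (0 : ℝ), mellin (fun x => kernel x τ) s * g τ := by
  have h := integral_integral_swap (f := fun x τ : ℝ => (x : ℂ) ^ (s - 1) * (kernel x τ * g τ))
    (integrable_kernel_mul_prod hg hs)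
  simp only [mellin, transformG, smul_eq_mul]
  simp_rw [← integral_const_mul, h, ← mul_assoc, integral_mul_const]

/-! ### The Mellin–Barnes integral as a superposition over the index -/

/-- The product `Γ(1/2-s) Γ(s+iτ) Γ(s-iτ)`. -/
noncomputable def gammaProduct (τ : ℝ) (s : ℂ) : ℂ :=
  Complex.Gamma (1 / 2 - s) *
    (Complex.Gamma (s + Complex.I * τ) * Complex.Gamma (s - Complex.I * τ))

theorem ofReal_sqrt_pi_ne_zero : (√Real.pi : ℂ) ≠ 0 := by
  exact_mod_cast (Real.sqrt_pos.2 Real.pi_pos).ne'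

/-- Duplication writes Γ(s)Γ(s+1/2) as 2^{1−2s}√π Γ(2s), which cancels both Γ(2s) and 4^{−s} from
the transform of the kernel. -/
theorem mellinQuotient_eq_integral {g : ℝ → ℂ} (hg : IntegrableOn g (Ioi 0)) {s : ℂ}
    (hs : 0 < s.re) :
    mellinQuotient g s =
      (8 * √Real.pi : ℂ)⁻¹ * ∫ τ in Ioi (0 : ℝ), gammaProduct τ s * g τ := by
  rw [mellinQuotient, mellin_transformG hg hs, ← integral_const_mul, ← integral_const_mul]
  refine integral_congr_ae (.of_forall fun τ => ?_)
  simp only [(hasMellin_kernel hs τ).2, gammaProduct]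
  have hd := Complex.Gamma_mul_Gamma_add_half s
  rw [add_comm s, Complex.cpow_sub _ _ two_ne_zero, Complex.cpow_one] at hd
  have h4 : (4 : ℂ) ^ (-s - 1) = (2 ^ (2 * s))⁻¹ / 4 := by
    rw [Complex.cpow_sub _ _ (by norm_num : (4 : ℂ) ≠ 0), Complex.cpow_one, Complex.cpow_neg]
    congr 2
    rw [← Complex.ofReal_ofNat 4, ofReal_cpow_eq_cexp four_pos, ← Complex.ofReal_ofNat 2,
      ofReal_cpow_eq_cexp two_pos, show (4 : ℝ) = 2 ^ 2 by norm_num, Real.log_pow]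
    push_cast
    ring_nf
  have h2 : (2 : ℂ) ^ (2 * s) ≠ 0 := by simp [Complex.cpow_eq_zero_iff]
  have hG : Complex.Gamma (2 * s) ≠ 0 := Complex.Gamma_ne_zero_of_re_pos (by simpa using hs)
  have hpi := ofReal_sqrt_pi_ne_zero
  rw [hd, h4]
  field_simp
  ring

theorem vertical_re (γ t : ℝ) : ((γ : ℂ) + t * Complex.I).re = γ := by simp

/-- Keeping only the decay of Γ(1/2−s) makes the bound independent of τ, as the exchange of
integrals requires. -/
theorem norm_gammaProduct_le {γ : ℝ} (hγ : 0 < γ) (τ t : ℝ) :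
    ‖gammaProduct τ (γ + t * Complex.I)‖ ≤
      ‖Complex.Gamma (1 / 2 - (γ + t * Complex.I))‖ * (Real.Gamma γ * Real.Gamma γ) := by
  rw [gammaProduct, norm_mul, norm_mul (Complex.Gamma _)]
  have h1 : ((γ : ℂ) + t * Complex.I + Complex.I * τ).re = γ := by simp
  have h2 : ((γ : ℂ) + t * Complex.I - Complex.I * τ).re = γ := by simp
  have h3 := norm_Gamma_le_Gamma_re (s := (γ : ℂ) + t * Complex.I + Complex.I * τ)
    (by rwa [h1])
  have h4 := norm_Gamma_le_Gamma_re (s := (γ : ℂ) + t * Complex.I - Complex.I * τ)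
    (by rwa [h2])
  rw [h1] at h3
  rw [h2] at h4
  have := Real.Gamma_pos_of_pos hγ
  gcongr

theorem integrable_Gamma_half_sub {γ : ℝ} (hγ : γ < 1 / 2) :
    Integrable (fun t : ℝ => Complex.Gamma (1 / 2 - (γ + t * Complex.I))) := by
  refine (integrable_Gamma_vertical (a := 1 / 2 - γ) (by linarith)).comp_neg.congr
    (.of_forall fun t => ?_)
  simp only
  congr 1
  push_cast
  ring

theorem continuous_gammaProduct {γ : ℝ} (hγ : 0 < γ) (hγ2 : γ < 1 / 2) :
    Continuous (fun p : ℝ × ℝ => gammaProduct p.2 (γ + p.1 * Complex.I)) := by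
  refine .mul ?_ (.mul ?_ ?_)
  · refine continuous_Gamma_comp (by fun_prop) fun p => ?_
    simp
    norm_num at hγ2
    linarith
  all_goals exact continuous_Gamma_comp (by fun_prop) (by simpa using hγ)

theorem verticalIntegrable_gammaProduct {γ : ℝ} (hγ : 0 < γ) (hγ2 : γ < 1 / 2) (τ : ℝ) :
    Complex.VerticalIntegrable (gammaProduct τ) γ := by
  refine ((integrable_Gamma_half_sub hγ2).norm.mul_const (Real.Gamma γ * Real.Gamma γ)).mono' ?_
    (.of_forall fun t => norm_gammaProduct_le hγ τ t)
  exact ((continuous_gammaProduct hγ hγ2).comp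
    (continuous_id.prodMk continuous_const : Continuous fun t : ℝ => (t, τ))).aestronglyMeasurable

theorem integrable_gammaProduct_mul_prod {γ : ℝ} (hγ : 0 < γ) (hγ2 : γ < 1 / 2) {g : ℝ → ℂ}
    (hg : IntegrableOn g (Ioi 0)) :
    Integrable (fun p : ℝ × ℝ => gammaProduct p.2 (γ + p.1 * Complex.I) * g p.2)
      (volume.prod (volume.restrict (Ioi 0))) := by
  refine (((integrable_Gamma_half_sub hγ2).norm.mul_const
    (Real.Gamma γ * Real.Gamma γ)).mul_prod hg.norm).mono' ?_ (.of_forall fun p => ?_)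
  · exact (continuous_gammaProduct hγ hγ2).aestronglyMeasurable.mul hg.1.comp_snd
  · rw [norm_mul]
    exact mul_le_mul_of_nonneg_right (norm_gammaProduct_le hγ _ _) (norm_nonneg _)

theorem verticalIntegrable_mellinQuotient {γ : ℝ} (hγ : 0 < γ) (hγ2 : γ < 1 / 2) {g : ℝ → ℂ}
    (hg : IntegrableOn g (Ioi 0)) : Complex.VerticalIntegrable (mellinQuotient g) γ := by
  refine ((integrable_gammaProduct_mul_prod hγ hγ2 hg).integral_prod_left.const_mul
    (8 * √Real.pi : ℂ)⁻¹).congr (.of_forall fun t => ?_)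
  have hs : 0 < ((γ : ℂ) + t * Complex.I).re := by rwa [vertical_re]
  simp only [mellinQuotient_eq_integral hg hs]

theorem mellinInv_mellinQuotient_eq_integral {γ : ℝ} (hγ : 0 < γ) (hγ2 : γ < 1 / 2)
    {g : ℝ → ℂ} (hg : IntegrableOn g (Ioi 0)) {y : ℝ} (hy : 0 < y) :
    mellinInv γ (mellinQuotient g) y =
      (8 * √Real.pi : ℂ)⁻¹ * ∫ τ in Ioi (0 : ℝ), mellinInv γ (gammaProduct τ) y * g τ := by
  have hint : Integrable (fun p : ℝ × ℝ => (y : ℂ) ^ (-((γ : ℂ) + p.1 * Complex.I)) *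
      (gammaProduct p.2 (γ + p.1 * Complex.I) * g p.2))
      (volume.prod (volume.restrict (Ioi 0))) := by
    refine Integrable.bdd_mul
      (f := fun p : ℝ × ℝ => (y : ℂ) ^ (-((γ : ℂ) + p.1 * Complex.I)))
      (g := fun p : ℝ × ℝ => gammaProduct p.2 (γ + p.1 * Complex.I) * g p.2) (c := y ^ (-γ))
      (integrable_gammaProduct_mul_prod hγ hγ2 hg) ?_ (.of_forall fun p => ?_)
    · refine Continuous.aestronglyMeasurable (Continuous.const_cpow (by fun_prop) (.inl ?_))
      exact_mod_cast hy.ne'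
    · rw [Complex.norm_cpow_eq_rpow_re_of_pos hy, Complex.neg_re, vertical_re]
  have hsw := integral_integral_swap (f := fun t τ : ℝ =>
    (y : ℂ) ^ (-((γ : ℂ) + t * Complex.I)) * (gammaProduct τ (γ + t * Complex.I) * g τ)) hint
  have h1 : ∀ t : ℝ, (y : ℂ) ^ (-((γ : ℂ) + t * Complex.I)) •
      mellinQuotient g (γ + t * Complex.I) = (8 * √Real.pi : ℂ)⁻¹ * ∫ τ in Ioi (0 : ℝ),
        (y : ℂ) ^ (-((γ : ℂ) + t * Complex.I)) * (gammaProduct τ (γ + t * Complex.I) * g τ) := by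
    intro t
    rw [mellinQuotient_eq_integral hg (by simpa using hγ), integral_const_mul, smul_eq_mul]
    ring
  simp only [mellinInv]
  simp_rw [h1]
  rw [integral_const_mul, hsw, ← mul_smul_comm, ← integral_smul]
  congr 1
  refine integral_congr_ae (.of_forall fun τ => ?_)
  simp only [smul_eq_mul, smul_mul_assoc, ← integral_mul_const]
  simp_rw [mul_assoc]

/-! ### The Mellin transform of the Macdonald function with exponential factor -/

/-- Euler's beta integral after the substitution `x = e^{-u}`. -/
theorem betaIntegral_eq_integral_exp_neg {a v : ℂ} (ha : 0 < a.re) (hv : 0 < v.re) :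
    IntegrableOn (fun u : ℝ => Complex.exp (-(a * u)) *
      ((1 - Real.exp (-u) : ℝ) : ℂ) ^ (v - 1)) (Ioi 0) ∧
    ∫ u in Ioi (0 : ℝ), Complex.exp (-(a * u)) * ((1 - Real.exp (-u) : ℝ) : ℂ) ^ (v - 1) =
      Complex.betaIntegral a v := by
  have hd : ∀ u ∈ Ioi (0 : ℝ), HasDerivWithinAt (fun u => Real.exp (-u)) (-Real.exp (-u))
      (Ioi 0) u := fun u _ => by
    simpa using ((hasDerivAt_neg u).exp).hasDerivWithinAt
  have hinj : InjOn (fun u => Real.exp (-u)) (Ioi (0 : ℝ)) := fun u _ v _ h => by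
    simpa using h
  have himg : (fun u => Real.exp (-u)) '' Ioi (0 : ℝ) = Ioo 0 1 := by
    ext x
    constructor
    · rintro ⟨u, hu, rfl⟩
      exact ⟨Real.exp_pos _, Real.exp_lt_one_iff.2 (by simpa using hu)⟩
    · rintro ⟨h0, h1⟩
      exact ⟨-Real.log x, by simpa using Real.log_neg h0 h1, by simp [Real.exp_log h0]⟩
  have hpt : ∀ u : ℝ, |(-Real.exp (-u))| • (((Real.exp (-u) : ℝ) : ℂ) ^ (a - 1) *
      (1 - ((Real.exp (-u) : ℝ) : ℂ)) ^ (v - 1)) =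
      Complex.exp (-(a * u)) * ((1 - Real.exp (-u) : ℝ) : ℂ) ^ (v - 1) := by
    intro u
    rw [abs_neg, Real.abs_exp, Complex.real_smul, ofReal_cpow_eq_cexp (Real.exp_pos _),
      Real.log_exp, Complex.ofReal_exp, ← mul_assoc, ← Complex.exp_add]
    push_cast
    ring_nf
  have hi := Complex.betaIntegral_convergent ha hv
  rw [intervalIntegrable_iff_integrableOn_Ioo_of_le zero_le_one, ← himg,
    integrableOn_image_iff_integrableOn_abs_deriv_smul measurableSet_Ioi hd hinj] at hi
  simp_rw [hpt] at hi
  refine ⟨hi, ?_⟩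
  rw [Complex.betaIntegral, intervalIntegral.integral_of_le zero_le_one,
    integral_Ioc_eq_integral_Ioo, ← himg,
    integral_image_eq_integral_abs_deriv_smul measurableSet_Ioi hd hinj]
  simp_rw [hpt]

/-- Since (cosh u − 1)/2 = e^u (1 − e^{−u})²/4, the left side is a sum of two beta integrands with
parameters s ∓ iτ and 1 − 2s. Their convergence at u = 0 is what forces Re s < 1/2. -/
theorem cosh_mul_cosh_sub_one_cpow {u : ℝ} (hu : 0 < u) (s : ℂ) (τ : ℝ) :
    Complex.cosh (Complex.I * τ * u) * (((Real.cosh u - 1) / 2 : ℝ) : ℂ) ^ (-s) =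
      4 ^ s / 2 * (Complex.exp (-((s - Complex.I * τ) * u)) *
          ((1 - Real.exp (-u) : ℝ) : ℂ) ^ ((1 - 2 * s) - 1) +
        Complex.exp (-((s + Complex.I * τ) * u)) *
          ((1 - Real.exp (-u) : ℝ) : ℂ) ^ ((1 - 2 * s) - 1)) := by
  have h1 : 0 < 1 - Real.exp (-u) := sub_pos.2 (Real.exp_lt_one_iff.2 (by linarith))
  have hD : (Real.cosh u - 1) / 2 = Real.exp u * (1 - Real.exp (-u)) ^ 2 / 4 := by
    have h2 : Real.exp u * Real.exp (-u) = 1 := by rw [← Real.exp_add]; simp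
    rw [Real.cosh_eq]
    linear_combination (2 - Real.exp (-u)) / 4 * h2
  have hch : Complex.cosh (Complex.I * τ * u) =
      (Complex.exp (Complex.I * τ * u) + Complex.exp (-(Complex.I * τ * u))) / 2 := rfl
  rw [hD, ofReal_cpow_eq_cexp (by positivity), ofReal_cpow_eq_cexp h1, hch,
    Real.log_div (by positivity) (by norm_num), Real.log_mul (by positivity) (by positivity),
    Real.log_exp, Real.log_pow, ← Complex.ofReal_ofNat 4, ofReal_cpow_eq_cexp four_pos,
    mul_add, div_mul_eq_mul_div, div_mul_eq_mul_div, div_mul_eq_mul_div, ← add_div, add_mul]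
  simp only [← Complex.exp_add]
  push_cast
  ring_nf

theorem one_div_Gamma_one_sub {z : ℂ} (hz : 0 < z.re) (hz1 : z.re < 1) :
    (Complex.Gamma (1 - z))⁻¹ = Complex.Gamma z * Complex.sin (Real.pi * z) / Real.pi := by
  have h := Complex.Gamma_mul_Gamma_one_sub z
  have h1 := Complex.Gamma_ne_zero_of_re_pos hz
  have h2 : Complex.Gamma (1 - z) ≠ 0 := Complex.Gamma_ne_zero_of_re_pos (by simpa using hz1)
  have hpi : (Real.pi : ℂ) ≠ 0 := by exact_mod_cast Real.pi_ne_zero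
  have hs : Complex.sin (Real.pi * z) ≠ 0 := fun h0 => by
    rw [h0, div_zero] at h
    exact mul_ne_zero h1 h2 h
  rw [eq_div_iff hs] at h
  generalize Complex.sin (Real.pi * z) = S at h
  field_simp
  linear_combination -h

/-- Reflection turns the denominators Γ(1 − (s ± iτ)) into sines, and these add up to 2 sin(πs)
cosh(πτ). -/
theorem Gamma_mul_betaIntegral_add_betaIntegral {s : ℂ} (hs : 0 < s.re) (hs2 : s.re < 1 / 2)
    (τ : ℝ) :
    Complex.Gamma s * (4 ^ s / 2 * (Complex.betaIntegral (s - Complex.I * τ) (1 - 2 * s) +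
      Complex.betaIntegral (s + Complex.I * τ) (1 - 2 * s))) =
    Complex.cosh (Real.pi * τ) / √Real.pi * gammaProduct τ s := by
  have hv : 0 < (1 - 2 * s).re := by simp; norm_num at hs2; linarith
  have hp : 0 < (s + Complex.I * τ).re := by simpa using hs
  have hm : 0 < (s - Complex.I * τ).re := by simpa using hs
  have hs1 : s.re < 1 := by linarith
  rw [Complex.betaIntegral_eq_Gamma_mul_div _ _ hm hv, Complex.betaIntegral_eq_Gamma_mul_div _ _ hp hv,
    show s - Complex.I * τ + (1 - 2 * s) = 1 - (s + Complex.I * τ) by ring,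
    show s + Complex.I * τ + (1 - 2 * s) = 1 - (s - Complex.I * τ) by ring,
    div_eq_mul_inv (_ * _) (Complex.Gamma _), div_eq_mul_inv (_ * _) (Complex.Gamma _),
    one_div_Gamma_one_sub hp (by simpa using hs1), one_div_Gamma_one_sub hm (by simpa using hs1)]
  have hsin : Complex.sin (Real.pi * (s + Complex.I * τ)) +
      Complex.sin (Real.pi * (s - Complex.I * τ)) =
      2 * Complex.sin (Real.pi * s) * Complex.cosh (Real.pi * τ) := by
    rw [mul_add, mul_sub, Complex.sin_add, Complex.sin_sub,
      show (Real.pi * (Complex.I * τ) : ℂ) = Real.pi * τ * Complex.I by ring, Complex.cos_mul_I]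
    ring
  have hr := one_div_Gamma_one_sub hs hs1
  have hdup := Complex.Gamma_mul_Gamma_add_half (1 / 2 - s)
  rw [show 1 / 2 - s + 1 / 2 = 1 - s by ring, show 2 * (1 / 2 - s) = 1 - 2 * s by ring,
    show 1 - (1 - 2 * s) = 2 * s by ring] at hdup
  have h4 : (4 : ℂ) ^ s = 2 ^ (2 * s) := by
    rw [← Complex.ofReal_ofNat 4, ofReal_cpow_eq_cexp four_pos, ← Complex.ofReal_ofNat 2,
      ofReal_cpow_eq_cexp two_pos, show (4 : ℝ) = 2 ^ 2 by norm_num, Real.log_pow]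
    push_cast
    ring_nf
  have h1 : Complex.Gamma (1 - s) ≠ 0 := Complex.Gamma_ne_zero_of_re_pos (by simpa using hs1)
  have hpi : (Real.pi : ℂ) ≠ 0 := by exact_mod_cast Real.pi_ne_zero
  have hpi2 := ofReal_sqrt_pi_ne_zero
  rw [eq_div_iff hpi, inv_mul_eq_div, div_eq_iff h1] at hr
  rw [gammaProduct, h4]
  -- Duplication at 1/2 − s produces Γ(1 − s), and reflection at s then eliminates it together with
  -- sin(πs).
  have key : Complex.Gamma s * 2 ^ (2 * s) * Complex.Gamma (1 - 2 * s) *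
      Complex.sin (Real.pi * s) * √Real.pi = Complex.Gamma (1 / 2 - s) * Real.pi := by
    linear_combination (-(Complex.Gamma s * Complex.sin (Real.pi * s))) * hdup -
      Complex.Gamma (1 / 2 - s) * hr
  generalize Complex.Gamma (1 / 2 - s) = G at key ⊢
  generalize Complex.sin (Real.pi * (s + Complex.I * τ)) = S₁ at hsin ⊢
  generalize Complex.sin (Real.pi * (s - Complex.I * τ)) = S₂ at hsin ⊢
  generalize Complex.cosh (Real.pi * τ) = C at hsin ⊢
  field_simp
  linear_combination (Complex.Gamma s * 2 ^ (2 * s) * √Real.pi * Complex.Gamma (1 - 2 * s) *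
    Complex.Gamma (s - Complex.I * τ) * Complex.Gamma (s + Complex.I * τ)) * hsin +
    (2 * Complex.Gamma (s - Complex.I * τ) * Complex.Gamma (s + Complex.I * τ) *
      C) * key

/-- The factor e^{y/2} shifts cosh u to cosh u − 1, which is still positive for u > 0, so
`hasMellin_integral_exp` applies. -/
theorem cexp_mul_besselK_eq_integral (τ y : ℝ) :
    Complex.exp (y / 2) * besselK (Complex.I * τ) (y / 2) =
      ∫ u in Ioi (0 : ℝ), Complex.cosh (Complex.I * τ * u) *
        Complex.exp (-(((Real.cosh u - 1) / 2 : ℝ) * y)) := by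
  rw [besselK, ← integral_const_mul]
  refine integral_congr_ae (.of_forall fun u => ?_)
  simp only
  rw [← mul_assoc, ← Complex.exp_add, mul_comm]
  congr 2
  push_cast
  ring

/-- Mellin transform of `e^{y/2} K_{iτ}(y/2)`. -/
theorem hasMellin_cexp_mul_besselK {s : ℂ} (hs : 0 < s.re) (hs2 : s.re < 1 / 2) (τ : ℝ) :
    HasMellin (fun y : ℝ => Complex.exp (y / 2) * besselK (Complex.I * τ) (y / 2)) s
      (Complex.cosh (Real.pi * τ) / √Real.pi * gammaProduct τ s) := by
  have hv : 0 < (1 - 2 * s).re := by simp; norm_num at hs2; linarith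
  have hp := betaIntegral_eq_integral_exp_neg (a := s + Complex.I * τ) (by simpa using hs) hv
  have hm := betaIntegral_eq_integral_exp_neg (a := s - Complex.I * τ) (by simpa using hs) hv
  have hEq : EqOn (fun u : ℝ => Complex.cosh (Complex.I * τ * u) *
      (((Real.cosh u - 1) / 2 : ℝ) : ℂ) ^ (-s)) _ (Ioi 0) :=
    fun u hu => cosh_mul_cosh_sub_one_cpow hu s τ
  simp_rw [cexp_mul_besselK_eq_integral]
  rw [← Gamma_mul_betaIntegral_add_betaIntegral hs hs2, ← hm.2, ← hp.2,
    ← integral_add hm.1 hp.1, ← integral_const_mul, ← setIntegral_congr_fun measurableSet_Ioi hEq]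
  refine hasMellin_integral_exp ?_ (by fun_prop) ?_ hs ?_
  · exact (Complex.continuous_cosh.comp (by fun_prop)).aestronglyMeasurable
  · filter_upwards [ae_restrict_mem measurableSet_Ioi] with u hu
    have := Real.one_lt_cosh.2 (ne_of_gt hu)
    linarith
  · exact (integrableOn_congr_fun hEq measurableSet_Ioi).2 ((hm.1.add hp.1).const_mul _)

/-! ### Mellin inversion and the final identity -/

theorem cosh_pi_mul_ne_zero (τ : ℝ) : Complex.cosh (Real.pi * τ) ≠ 0 := by
  rw [← Complex.ofReal_mul, ← Complex.ofReal_cosh]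
  exact_mod_cast (Real.cosh_pos _).ne'

theorem continuousAt_besselK_div_two (τ : ℝ) {y : ℝ} (hy : 0 < y) :
    ContinuousAt (fun p : ℝ × ℝ => besselK (Complex.I * p.1) (p.2 / 2)) (τ, y) :=
  ContinuousAt.comp (f := fun p : ℝ × ℝ => (p.1, (p.2 / 2 : ℂ)))
    (g := fun p : ℝ × ℂ => besselK (Complex.I * p.1) p.2) (x := (τ, y))
    (continuousAt_besselK τ (by
      rw [show (y / 2 : ℂ) = ((y / 2 : ℝ) : ℂ) by push_cast; ring, Complex.ofReal_re]
      positivity)) (by fun_prop)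

theorem mellinInv_gammaProduct {γ : ℝ} (hγ : 0 < γ) (hγ2 : γ < 1 / 2) (τ : ℝ) {y : ℝ}
    (hy : 0 < y) :
    mellinInv γ (gammaProduct τ) y = √Real.pi / Complex.cosh (Real.pi * τ) *
      (Complex.exp (y / 2) * besselK (Complex.I * τ) (y / 2)) := by
  have hm : ∀ t : ℝ, mellin (fun y : ℝ => Complex.exp (y / 2) * besselK (Complex.I * τ) (y / 2))
      (γ + t * Complex.I) =
      Complex.cosh (Real.pi * τ) / √Real.pi * gammaProduct τ (γ + t * Complex.I) := fun t =>
    (hasMellin_cexp_mul_besselK (by rwa [vertical_re]) (by rwa [vertical_re]) τ).2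
  have hc : ContinuousAt (fun y : ℝ => Complex.exp (y / 2) * besselK (Complex.I * τ) (y / 2)) y :=
    ContinuousAt.mul (by fun_prop) ((continuousAt_besselK_div_two τ hy).comp
      (f := fun y : ℝ => (τ, y)) (by fun_prop))
  have hi : Complex.VerticalIntegrable (mellin fun y : ℝ =>
      Complex.exp (y / 2) * besselK (Complex.I * τ) (y / 2)) γ :=
    ((verticalIntegrable_gammaProduct hγ hγ2 τ).const_mul _).congr
      (.of_forall fun t => (hm t).symm)
  rw [← mellinInv_mellin_eq γ _ hy (hasMellin_cexp_mul_besselK (by simpa using hγ)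
    (by simpa using hγ2) τ).1 hi hc]
  simp only [mellinInv]
  simp_rw [hm, smul_eq_mul]
  rw [mul_smul_comm, ← integral_const_mul]
  congr 1
  refine integral_congr_ae (.of_forall fun t => ?_)
  have := cosh_pi_mul_ne_zero τ
  have := ofReal_sqrt_pi_ne_zero
  simp only
  field_simp

/-- The factor multiplying g is bounded: |K_{iτ}(y/2)| has a bound independent of τ, and cosh(πτ) ≥
1. -/
theorem integrableOn_besselK_mul_div_cosh {g : ℝ → ℂ} (hg : IntegrableOn g (Ioi 0)) {y : ℝ}
    (hy : 0 < y) :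
    IntegrableOn (fun τ : ℝ => besselK (Complex.I * τ) (y / 2) *
      (g τ / Complex.cosh (Real.pi * τ))) (Ioi 0) := by
  have hre : (y / 2 : ℂ).re = y / 2 := by
    rw [show (y / 2 : ℂ) = ((y / 2 : ℝ) : ℂ) by push_cast; ring, Complex.ofReal_re]
  set C := ∫ u in Ioi (0 : ℝ), Real.exp (-((y / 2 : ℂ).re * Real.cosh u))
  have hK : Continuous fun τ : ℝ => besselK (Complex.I * τ) (y / 2) :=
    continuous_iff_continuousAt.2 fun τ => (continuousAt_besselK_div_two τ hy).comp
      (f := fun τ : ℝ => (τ, y)) (by fun_prop)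
  have h : IntegrableOn (fun τ : ℝ => besselK (Complex.I * τ) (y / 2) /
      Complex.cosh (Real.pi * τ) * g τ) (Ioi 0) := by
    refine Integrable.bdd_mul (c := C) hg (Continuous.aestronglyMeasurable ?_)
      (.of_forall fun τ => ?_)
    · exact hK.div (Complex.continuous_cosh.comp (by fun_prop)) cosh_pi_mul_ne_zero
    · rw [norm_div]
      have h1 : 1 ≤ ‖Complex.cosh (Real.pi * τ)‖ := by
        rw [← Complex.ofReal_mul, ← Complex.ofReal_cosh, Complex.norm_real]
        exact (Real.one_le_cosh _).trans (le_abs_self _)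
      exact (div_le_self (norm_nonneg _) h1).trans
        (norm_besselK_le (by rw [hre]; positivity) τ)
  refine h.congr (.of_forall fun τ => ?_)
  simp only
  ring

theorem mellinInv_mellinQuotient {γ : ℝ} (hγ : 0 < γ) (hγ2 : γ < 1 / 2) {g : ℝ → ℂ}
    (hg : IntegrableOn g (Ioi 0)) {y : ℝ} (hy : 0 < y) :
    mellinInv γ (mellinQuotient g) y = Complex.exp (y / 2) / 8 *
      ∫ τ in Ioi (0 : ℝ), besselK (Complex.I * τ) (y / 2) *
        (g τ / Complex.cosh (Real.pi * τ)) := by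
  rw [mellinInv_mellinQuotient_eq_integral hγ hγ2 hg hy, ← integral_const_mul,
    ← integral_const_mul]
  refine integral_congr_ae (.of_forall fun τ => ?_)
  simp only [mellinInv_gammaProduct hγ hγ2 τ hy]
  have := cosh_pi_mul_ne_zero τ
  have := ofReal_sqrt_pi_ne_zero
  field_simp

end KelvinIndex

theorem theorem4 (γ : ℝ) (hγ : 0 < γ) (g : ℝ → ℂ) (hg : IntegrableOn g (Ioi (0 : ℝ))) :
    -- the integrals defining `Gg` and the constant `C_γ` converge absolutely
    (∀ x : ℝ, 0 < x → IntegrableOn (fun τ : ℝ => KelvinIndex.kernel x τ * g τ) (Ioi (0 : ℝ))) ∧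
    Integrable (fun t : ℝ => Complex.Gamma (2 * ((γ : ℂ) + (t : ℂ) * Complex.I)) ^ 2) ∧
    -- `x ^ γ (Gg)(x)` is continuous and bounded on `(0, ∞)`, with the explicit bound
    ContinuousOn (fun x : ℝ => ((x ^ γ : ℝ) : ℂ) * KelvinIndex.transformG g x) (Ioi (0 : ℝ)) ∧
    (∀ x : ℝ, 0 < x → ‖((x ^ γ : ℝ) : ℂ) * KelvinIndex.transformG g x‖ ≤
      KelvinIndex.constC γ * ∫ τ in Ioi (0 : ℝ), ‖g τ‖) ∧
    -- the Mellin-Barnes identity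
    (γ < 1 / 2 → KelvinIndex.MemLWeighted γ (KelvinIndex.transformG g) →
      Complex.VerticalIntegrable (fun s : ℂ =>
        ((‖s‖ ^ (1 / 2 - 2 * γ) * Real.exp (Real.pi * ‖s‖ / 2) : ℝ) : ℂ) *
          mellin (KelvinIndex.transformG g) s) γ →
      Complex.VerticalIntegrable (KelvinIndex.mellinQuotient g) γ ∧
      ∀ y : ℝ, 0 < y →
        IntegrableOn (fun τ : ℝ => KelvinIndex.besselK (Complex.I * τ) (y / 2) *
          (g τ / Complex.cosh (Real.pi * τ))) (Ioi (0 : ℝ)) ∧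
        mellinInv γ (KelvinIndex.mellinQuotient g) y =
          Complex.exp (y / 2) / 8 *
            ∫ τ in Ioi (0 : ℝ), KelvinIndex.besselK (Complex.I * τ) (y / 2) *
              (g τ / Complex.cosh (Real.pi * τ))) := by
  refine ⟨fun x hx => KelvinIndex.integrableOn_kernel_mul hγ hg hx,
    KelvinIndex.integrable_Gamma_two_mul_sq hγ, ?_,
    fun x hx => KelvinIndex.norm_rpow_mul_transformG_le hγ hg hx, fun hγ2 _ _ =>
    ⟨KelvinIndex.verticalIntegrable_mellinQuotient hγ hγ2 hg, fun y hy =>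
      ⟨KelvinIndex.integrableOn_besselK_mul_div_cosh hg hy,
        KelvinIndex.mellinInv_mellinQuotient hγ hγ2 hg hy⟩⟩⟩
  refine ContinuousOn.mul ?_ (KelvinIndex.continuousOn_transformG hγ hg)
  exact Complex.continuous_ofReal.comp_continuousOn
    (continuousOn_id.rpow_const fun x _ => .inr hγ.le)
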